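/- **Setting.** All gradient systems live on the state space $\mathbb R$. A *dissipation potential* is a map $\mathcal R:\mathbb R\times\mathbb R\to[0,\infty]$, $(q,v)\mapsto\mathcal R(q,v)$, such that each $\mathcal R(q,\cdot)$ is convex and lower semicontinuous with $\mathcal R(q,0)=0$; its dual is $\mathcal R^*(q,\xi)=\sup_{v}(\xi v-\mathcal R(q,v))$. A *gradient system* $(\mathbb R,\mathcal E,\mathcal R)$ consists of an energy $\mathcal E\in C^1(\mathbb R)$ and a dissipation potential $\mathcal R$. All $\Gamma$-limits are for $\varepsilon\to0^+$. Functionals on $C([0,T];\mathbb R)$ (with uniform convergence) that are given by integrals involving $\dot q$ take the value $+\infty$ at curves that are not absolutely continuous. *Simple EDP convergence* of $(\mathbb R,\mathcal E_\varepsilon,\mathcal R_\varepsilon)$ to $(\mathbb R,\mathcal E_0,\tilde{\mathcal R}_0)$ means that $\mathcal E_\varepsilon\to\mathcal E_0$ in the sense of $\Gamma$-convergence on $\mathbb R$ and, for every $T>0$, the functionals $q\mapsto\int_0^T\mathcal R_\varepsilon(q,\dot q)+\mathcal R_\varepsilon^*(q,-\mathcal E_\varepsilon'(q))\,dt$ $\Gamma$-converge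 in $C([0,T];\mathbb R)$ to $q\mapsto\int_0^T\tilde{\mathcal R}_0(q,\dot q)+\tilde{\mathcal R}_0^*(q,-\mathcal E_0'(q))\,dt$. *Basic assumption.* $\mathcal E_\varepsilon\to\mathcal E_0$ in the sense of $\Gamma$-convergence, and there is a Borel function $\mathcal N_0:\mathbb R^3\to[0,\infty]$ such that, for every $T>0$ and every $\mathcal F\in C^1(\mathbb R)$, the functionals $q\mapsto\int_0^T\mathcal R_\varepsilon(q,\dot q)+\mathcal R_\varepsilon^*(q,-\mathcal E_\varepsilon'(q)-\mathcal F'(q))\,dt$ $\Gamma$-converge in $C([0,T];\mathbb R)$ to $q\mapsto\int_0^T\mathcal N_0(q,\dot q,-\mathcal F'(q))\,dt$; moreover $v\mapsto\mathcal N_0(q,v,\eta)$ is convex and lower semicontinuous, and $\mathcal M_0(q,v,\xi):=\mathcal N_0(q,v,\xi+\mathcal E_0'(q))$ satisfies $\mathcal M_0(q,v,\xi)\ge\xi v$ and $\mathcal M_0(q,v,\xi)\ge\mathcal M_0(q,0,\xi)$. Under the basic assumption (for some such $\mathcal N_0$), the family *tilt-EDP converges* to $(\mathbb R,\mathcal E_0,\hat{\mathcal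 R}_0)$ if $\mathcal M_0(q,v,\xi)=\hat{\mathcal R}_0(q,v)+\hat{\mathcal R}_0^*(q,\xi)$ for all $q,v,\xi$, and it *contact-EDP converges* to $(\mathbb R,\mathcal E_0,\mathcal R_{\rm eff})$ if, for every $q$, $\{(v,\xi):\mathcal M_0(q,v,\xi)=\xi v\}$ is the graph of the subdifferential $\partial_v\mathcal R_{\rm eff}(q,\cdot)$. **Theorem.** Let $\mu\in C^0(\mathbb R^2)$ be 1-periodic in its second variable with $0<\underline m\le\mu\le\overline m<\infty$, and let $\mathcal R_\varepsilon(q,v)=\tfrac12\mu(q,q/\varepsilon)v^2$. 1. For every $\mathcal E\in C^1(\mathbb R)$, the family $(\mathbb R,\mathcal E,\mathcal R_\varepsilon)$ contact-EDP converges to $(\mathbb R,\mathcal E,\mathcal R_{\rm eff})$, where $\mathcal R_{\rm eff}(q,v)=\tfrac12\bar\mu(q)v^2$ with $\bar\mu(q)=\int_0^1\mu(q,y)\,dy$; in particular $\mathcal R_{\rm eff}$ is quadratic in $v$ and independent of $\mathcal E$. 2. For every $\mathcal E\in C^1(\mathbb R)$ there is exactly one dissipation potential $\tilde{\mathcal R}_0^{\mathcal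 E}$, continuous on $\mathbb R\times\mathbb R$, such that $(\mathbb R,\mathcal E,\mathcal R_\varepsilon)$ converges to $(\mathbb R,\mathcal E,\tilde{\mathcal R}_0^{\mathcal E})$ in the simple EDP sense. If $\mu(q,\cdot)$ is not constant, then $\tilde{\mathcal R}_0^{\mathcal E}(q,\cdot)$ is not quadratic (not of the form $v\mapsto\tfrac a2v^2$) whenever $\mathcal E'(q)\neq0$, and it depends on $\mathcal E$: $\tilde{\mathcal R}_0^{\mathcal E_1}(q,\cdot)\neq\tilde{\mathcal R}_0^{\mathcal E_2}(q,\cdot)$ whenever $\mathcal E_1,\mathcal E_2\in C^1(\mathbb R)$ satisfy $|\mathcal E_1'(q)|\neq|\mathcal E_2'(q)|$. 3. If $\mu(q,\cdot)$ is not constant for at least one $q$, then for every $\mathcal E\in C^1(\mathbb R)$ the family $(\mathbb R,\mathcal E,\mathcal R_\varepsilon)$ does not tilt-EDP converge to any gradient system. -/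

import Mathlib

open Set Filter Topology MeasureTheory
open scoped ENNReal NNReal

/-! Gradient systems on the state space `ℝ`; tangent and cotangent spaces are identified with `ℝ`,
and the duality pairing is `⟨ξ, v⟩ = ξ * v`. -/

/-- Dissipation potentials on the real line: convex, lower semicontinuous functions
`R : ℝ → [0, ∞]` with `R 0 = 0`. -/
structure IsDissipationPotential (R : ℝ → ℝ≥0∞) : Prop where
  convex : ConvexOn ℝ≥0 univ R
  lsc : LowerSemicontinuous R
  zero : R 0 = 0

/-- The Legendre-Fenchel dual `R* ξ = sup_v (ξ v - R v)`. The subtraction in `[0, ∞]` is truncated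
at `0`, which does not change the supremum if `R 0 = 0`; see `coe_legendreDual`. -/
noncomputable def legendreDual (R : ℝ → ℝ≥0∞) (ξ : ℝ) : ℝ≥0∞ :=
  ⨆ v : ℝ, (ENNReal.ofReal (ξ * v) - R v)

theorem coe_legendreDual {R : ℝ → ℝ≥0∞} (hR : R 0 = 0) (ξ : ℝ) :
    (legendreDual R ξ : EReal) = ⨆ v : ℝ, (((ξ * v : ℝ) : EReal) - (R v : EReal)) := by
  have h0 : (0 : EReal) ≤ ⨆ v : ℝ, (((ξ * v : ℝ) : EReal) - (R v : EReal)) :=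
    le_iSup_of_le 0 (by simp [hR])
  have key : ∀ v : ℝ, ENNReal.ofReal (ξ * v) - R v
      = (((ξ * v : ℝ) : EReal) - (R v : EReal)).toENNReal := fun v => by
    rw [EReal.toENNReal_sub (EReal.coe_ennreal_nonneg _), EReal.real_coe_toENNReal,
      EReal.toENNReal_coe]
  rw [← EReal.coe_toENNReal h0]
  refine congrArg _ (le_antisymm (iSup_le fun v => ?_) ?_)
  · rw [key v]
    exact EReal.toENNReal_le_toENNReal
      (le_iSup (fun v : ℝ => ((ξ * v : ℝ) : EReal) - (R v : EReal)) v)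
  · rw [← EReal.coe_ennreal_le_coe_ennreal_iff, EReal.coe_toENNReal h0]
    refine iSup_le fun v => ?_
    refine (le_max_right (0 : EReal) _).trans ?_
    rw [← EReal.coe_toENNReal_eq_max, ← key v, EReal.coe_ennreal_le_coe_ennreal_iff]
    exact le_iSup (fun v => ENNReal.ofReal (ξ * v) - R v) v

/-- Convexity, lower semicontinuity and normalization of the quadratic potential. -/
theorem isDissipationPotential_quadratic (a : ℝ) :
    IsDissipationPotential (fun v => ENNReal.ofReal (a / 2 * v ^ 2)) where
  zero := by simp
  lsc := (ENNReal.continuous_ofReal.comp (by fun_prop)).lowerSemicontinuous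
  convex := by
    refine ⟨convex_univ, fun x _ y _ s t _ _ hst => ?_⟩
    have hst' : (s : ℝ) + t = 1 := by exact_mod_cast hst
    change ENNReal.ofReal (a / 2 * ((s : ℝ) * x + (t : ℝ) * y) ^ 2)
      ≤ (s : ℝ≥0∞) * ENNReal.ofReal (a / 2 * x ^ 2) + (t : ℝ≥0∞) * ENNReal.ofReal (a / 2 * y ^ 2)
    rcases le_total a 0 with ha | ha
    · rw [ENNReal.ofReal_of_nonpos]
      · exact zero_le
      · exact mul_nonpos_of_nonpos_of_nonneg (by linarith) (sq_nonneg _)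
    · rw [← ENNReal.ofReal_coe_nnreal, ← ENNReal.ofReal_coe_nnreal,
        ← ENNReal.ofReal_mul (NNReal.coe_nonneg s), ← ENNReal.ofReal_mul (NNReal.coe_nonneg t),
        ← ENNReal.ofReal_add (by positivity) (by positivity)]
      apply ENNReal.ofReal_le_ofReal
      have hs : (s : ℝ) = 1 - t := by linarith
      have h1 : 0 ≤ a / 2 * ((s : ℝ) * t * (x - y) ^ 2) := by positivity
      rw [hs] at h1 ⊢
      nlinarith [h1]

/-- A state-dependent dissipation potential `R : Tℝ → [0, ∞]`, `(q, v) ↦ R q v`. -/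
structure DissipationPotential where
  toFun : ℝ → ℝ → ℝ≥0∞
  isDissipationPotential : ∀ q, IsDissipationPotential (toFun q)

instance : CoeFun DissipationPotential (fun _ => ℝ → ℝ → ℝ≥0∞) := ⟨DissipationPotential.toFun⟩

/-- Continuously differentiable functionals on the state space `ℝ` (energies and tilts). -/
abbrev C1Fun : Type := {E : ℝ → ℝ // ContDiff ℝ 1 E}

/-- A gradient system `(ℝ, E, R)`. -/
structure GradientSystem where
  energy : C1Fun
  diss : DissipationPotential

/-- Gamma-convergence of `F ε` to `F₀` as `ε → 0+` (on a first-countable space). -/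
def GammaConverges {X β : Type*} [TopologicalSpace X] [CompleteLinearOrder β]
    (F : ℝ → X → β) (F₀ : X → β) : Prop :=
  (∀ (x : X) (u : ℝ → X), Tendsto u (𝓝[>] 0) (𝓝 x) →
      F₀ x ≤ liminf (fun ε => F ε (u ε)) (𝓝[>] 0)) ∧
  (∀ x : X, ∃ u : ℝ → X, Tendsto u (𝓝[>] 0) (𝓝 x) ∧
      limsup (fun ε => F ε (u ε)) (𝓝[>] 0) ≤ F₀ x)

open Classical in
/-- The functional `q ↦ ∫₀ᵀ L (q t) (q' t) dt` on `C([0, T]; ℝ)`, with the value `∞` at curves that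
are not absolutely continuous. -/
noncomputable def actionFunctional {T : ℝ} (hT : 0 < T) (L : ℝ → ℝ → ℝ≥0∞)
    (q : C(Icc (0 : ℝ) T, ℝ)) : ℝ≥0∞ :=
  if AbsolutelyContinuousOnInterval (IccExtend hT.le q) 0 T then
    ∫⁻ t in Icc (0 : ℝ) T, L (IccExtend hT.le q t) (deriv (IccExtend hT.le q) t)
  else ∞

/-- The dissipation functional of `G` tilted by `F`,
`q ↦ ∫₀ᵀ (R (q, q') + R* (q, - DE(q) - DF(q))) dt`. -/
noncomputable def tiltedDissipation {T : ℝ} (hT : 0 < T) (G : GradientSystem) (F : C1Fun) :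
    C(Icc (0 : ℝ) T, ℝ) → ℝ≥0∞ :=
  actionFunctional hT fun q v =>
    G.diss q v + legendreDual (G.diss q) (-deriv G.energy.1 q - deriv F.1 q)

/-- Gamma-convergence of the energies on `ℝ`. -/
def EnergyConverges (G : ℝ → GradientSystem) (E₀ : C1Fun) : Prop :=
  GammaConverges (fun ε q => (((G ε).energy.1 q : ℝ) : EReal)) (fun q => ((E₀.1 q : ℝ) : EReal))

/-- Simple EDP convergence of the family `G ε` to `G₀` as `ε → 0+`. -/
def SimpleEDPConverges (G : ℝ → GradientSystem) (G₀ : GradientSystem) : Prop :=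
  EnergyConverges G G₀.energy ∧
  ∀ (T : ℝ) (hT : 0 < T),
    GammaConverges
      (fun ε => actionFunctional hT fun q v =>
        (G ε).diss q v + legendreDual ((G ε).diss q) (-deriv (G ε).energy.1 q))
      (actionFunctional hT fun q v =>
        G₀.diss q v + legendreDual (G₀.diss q) (-deriv G₀.energy.1 q))

/-- `M₀ (q, v, ξ) = N₀ (q, v, ξ + DE₀(q))`. -/
noncomputable def effectiveIntegrand (E₀ : C1Fun) (N₀ : ℝ → ℝ → ℝ → ℝ≥0∞) (q v ξ : ℝ) : ℝ≥0∞ :=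
  N₀ q v (ξ + deriv E₀.1 q)

/-- The basic assumptions behind EDP convergence with tilting: the energies Gamma-converge to `E₀`,
and for all horizons `T` and all tilts `F` the tilted dissipation functionals Gamma-converge in
`C([0, T]; ℝ)` to `q ↦ ∫₀ᵀ N₀ (q, q', - DF(q)) dt`, with an integrand `N₀` that depends neither on
`T` nor on `F`. -/
structure BasicAssumption (G : ℝ → GradientSystem) (E₀ : C1Fun)
    (N₀ : ℝ → ℝ → ℝ → ℝ≥0∞) : Prop where
  energy : EnergyConverges G E₀
  measurable : Measurable fun p : ℝ × ℝ × ℝ => N₀ p.1 p.2.1 p.2.2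
  dissipation : ∀ (T : ℝ) (hT : 0 < T) (F : C1Fun),
    GammaConverges (fun ε => tiltedDissipation hT (G ε) F)
      (actionFunctional hT fun q v => N₀ q v (-deriv F.1 q))
  convex : ∀ q η, ConvexOn ℝ≥0 univ fun v => N₀ q v η
  lsc : ∀ q η, LowerSemicontinuous fun v => N₀ q v η
  young : ∀ q v ξ, ((ξ * v : ℝ) : EReal) ≤ (effectiveIntegrand E₀ N₀ q v ξ : EReal)
  min_zero : ∀ q v ξ, effectiveIntegrand E₀ N₀ q 0 ξ ≤ effectiveIntegrand E₀ N₀ q v ξ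

/-- `M = R ⊕ R*`. -/
def IsDualDissipationSum (M : ℝ → ℝ → ℝ≥0∞) (R : ℝ → ℝ≥0∞) : Prop :=
  ∀ v ξ, M v ξ = R v + legendreDual R ξ

/-- The contact set of `M`, a set of pairs `(v, ξ)`. -/
def contactSet (M : ℝ → ℝ → ℝ≥0∞) : Set (ℝ × ℝ) :=
  {p | (M p.1 p.2 : EReal) = ((p.2 * p.1 : ℝ) : EReal)}

/-- The graph of the convex subdifferential of `R`: the pairs `(v, ξ)` with `R v < ∞` and
`R w ≥ R v + ξ (w - v)` for all `w`. -/
def subdifferentialGraph (R : ℝ → ℝ≥0∞) : Set (ℝ × ℝ) :=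
  {p | R p.1 ≠ ∞ ∧ ∀ w : ℝ, (R p.1 : EReal) + ((p.2 * (w - p.1) : ℝ) : EReal) ≤ (R w : EReal)}

/-- `R` is a contact-equivalent dissipation potential for `M`. -/
def IsContactEquivalent (M : ℝ → ℝ → ℝ≥0∞) (R : ℝ → ℝ≥0∞) : Prop :=
  contactSet M = subdifferentialGraph R

/-- EDP convergence with tilting (tilt-EDP convergence). -/
def TiltEDPConverges (G : ℝ → GradientSystem) (G₀ : GradientSystem) : Prop :=
  ∃ N₀ : ℝ → ℝ → ℝ → ℝ≥0∞, BasicAssumption G G₀.energy N₀ ∧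
    ∀ q, IsDualDissipationSum (effectiveIntegrand G₀.energy N₀ q) (G₀.diss q)

/-- Contact EDP convergence with tilting (contact-EDP convergence). -/
def ContactEDPConverges (G : ℝ → GradientSystem) (G₀ : GradientSystem) : Prop :=
  ∃ N₀ : ℝ → ℝ → ℝ → ℝ≥0∞, BasicAssumption G G₀.energy N₀ ∧
    ∀ q, IsContactEquivalent (effectiveIntegrand G₀.energy N₀ q) (G₀.diss q)

/-- The wiggly dissipation potential `R_ε (q, v) = μ (q, q / ε) / 2 * v ^ 2`. -/
noncomputable def wigglyDissipation (μ : ℝ → ℝ → ℝ) (ε : ℝ) : DissipationPotential where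
  toFun q v := ENNReal.ofReal (μ q (q / ε) / 2 * v ^ 2)
  isDissipationPotential q := isDissipationPotential_quadratic (μ q (q / ε))

/-- The effective dissipation potential `R_eff (q, v) = μ̄ (q) / 2 * v ^ 2`, where
`μ̄ (q) = ∫₀¹ μ (q, y) dy`. -/
noncomputable def effectiveDissipation (μ : ℝ → ℝ → ℝ) : DissipationPotential where
  toFun q v := ENNReal.ofReal ((∫ y in (0 : ℝ)..1, μ q y) / 2 * v ^ 2)
  isDissipationPotential q := isDissipationPotential_quadratic (∫ y in (0 : ℝ)..1, μ q y)

/-- The family `ε ↦ (ℝ, E, R_ε)`. -/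
noncomputable def wigglySystem (μ : ℝ → ℝ → ℝ) (E : C1Fun) (ε : ℝ) : GradientSystem :=
  ⟨E, wigglyDissipation μ ε⟩

/-!
The proof rests on one homogenization theorem, `IsProfileField.gammaConverges`. For coefficients
`a q y`, `b q y` that are `1`-periodic in `y`, the functionals
`∫ a (q, q / ε) / 2 * q' ^ 2 + b (q, q / ε)` Gamma-converge to `∫ cellEnergy (a q) (b q) q'`, where
`cellEnergy a b v = sup_{l ≤ min b} (l + |v| * ∫₀¹ √(2 a (b - l)))`.
The formula comes from Young's inequality `a / 2 * v ^ 2 + b ≥ l + |v| * √(2 a (b - l))`: each level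
`l` bounds the action from below by a length in a Jacobi metric, and in one dimension the length of
a curve only sees its end points.

For the lower bound (`lintegral_cellEnergy_le_liminf`), let `ψ t` be the limit inferior of the
actions on `[0, t]`. It is monotone, and freezing the coefficients on a short interval gives
`ψ' ≥ cellEnergy (a q) (b q) q'` wherever `ψ` and `q` are differentiable; the integral of the
derivative of a monotone function is at most its increment. For the upper bound
(`eventually_exists_recovery`), a fine partition is chosen. On each of its intervals
the curve waits at a minimum of `b` and then follows an extremal `a / 2 * q' ^ 2 = b - l`,
for which Young's inequality is an equality; `IsProfile.exists_level` finds a level `l` at which the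
waiting is affordable. Jensen's inequality needs no work, because `cellEnergy` is a supremum of
affine functions of `|v|`.

With `a = μ` and `b = ξ ^ 2 / (2 μ)` this identifies the effective density `M₀ (q, v, ξ)`. Level `0`
contributes `|v| * |ξ|`, so that `M₀ (q, v, ξ) ≥ ξ * v`, with equality exactly when level `0` is
optimal and `v` has the sign of `ξ`; the derivative in `l` at `0` turns this into `ξ = μ̄ v`, which is
contact-EDP convergence. The simple EDP limit is `M₀ (q, v, ξ) - M₀ (q, 0, ξ)` at `ξ = -E' (q)`. At
the top level it has the slope `|ξ| * stickSlope` at `v = 0`, which is not zero unless `ξ = 0` or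
`μ (q, ·)` is constant; hence the limit is neither quadratic nor independent of `E`.
If `M₀ = R ⊕ R*`, then `R* = M₀ (q, 0, ·)` forces `R (q, v) ≥ max μ / 2 * v ^ 2`, which contradicts
`M₀ (q, v, μ̄ v) = μ̄ v ^ 2` because `μ̄ < max μ`.
-/

/-! ### The effective Lagrangian of a periodic cell problem -/

/-- The coefficients of a periodic Lagrangian `(y, v) ↦ a y / 2 * v ^ 2 + b y` on the unit cell. -/
structure IsProfile (a b : ℝ → ℝ) : Prop where
  cont_a : Continuous a
  cont_b : Continuous b
  per_a : Function.Periodic a 1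
  per_b : Function.Periodic b 1
  pos_a : ∀ y, 0 < a y
  nonneg_b : ∀ y, 0 ≤ b y

/-- The line element of the Jacobi metric of the Lagrangian `a / 2 * v ^ 2 + b` at level `l`. -/
noncomputable def jacobiWeight (a b : ℝ → ℝ) (l y : ℝ) : ℝ := √(2 * a y * (b y - l))

/-- The Jacobi length of the unit cell at level `l`. -/
noncomputable def jacobiMean (a b : ℝ → ℝ) (l : ℝ) : ℝ := ∫ y in (0 : ℝ)..1, jacobiWeight a b l y

/-- The effective Lagrangian `v ↦ sup_{l ≤ min b} (l + |v| * jacobiMean a b l)`. The supremum is that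
of a nonempty and bounded set if `IsProfile a b`. -/
noncomputable def cellEnergy (a b : ℝ → ℝ) (v : ℝ) : ℝ :=
  ⨆ l : {l : ℝ // ∀ y, l ≤ b y}, ((l : ℝ) + |v| * jacobiMean a b l)

theorem jacobiWeight_nonneg (a b : ℝ → ℝ) (l y : ℝ) : 0 ≤ jacobiWeight a b l y := Real.sqrt_nonneg _

theorem jacobiMean_nonneg (a b : ℝ → ℝ) (l : ℝ) : 0 ≤ jacobiMean a b l :=
  intervalIntegral.integral_nonneg zero_le_one fun y _ => jacobiWeight_nonneg a b l y

theorem exists_abs_le_of_periodic {f : ℝ → ℝ} (hf : Continuous f) (hp : Function.Periodic f 1) :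
    ∃ C, 0 < C ∧ ∀ y, |f y| ≤ C := by
  obtain ⟨C, hC⟩ := (hp.isBounded_of_continuous one_ne_zero hf).exists_norm_le
  exact ⟨max C 1, by positivity, fun y => (hC _ (mem_range_self y)).trans (le_max_left _ _)⟩

theorem exists_forall_ge_of_periodic {f : ℝ → ℝ} (hf : Continuous f) (hp : Function.Periodic f 1) :
    ∃ z, ∀ y, f z ≤ f y := by
  obtain ⟨c, ⟨z, rfl⟩, hz⟩ :=
    (hp.compact_of_continuous one_ne_zero hf).exists_isLeast (range_nonempty f)
  exact ⟨z, fun y => hz (mem_range_self y)⟩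

namespace IsProfile

variable {a b : ℝ → ℝ}

theorem continuous_jacobiWeight (h : IsProfile a b) (l : ℝ) : Continuous (jacobiWeight a b l) := by
  have := h.cont_a
  have := h.cont_b
  unfold jacobiWeight
  fun_prop

theorem periodic_jacobiWeight (h : IsProfile a b) (l : ℝ) :
    Function.Periodic (jacobiWeight a b l) 1 := fun y => by
  simp only [jacobiWeight, h.per_a y, h.per_b y]

/-- Young's inequality, the calibration by the Jacobi metric at level `l`. -/
theorem level_add_le (h : IsProfile a b) {l y : ℝ} (hl : l ≤ b y) (v : ℝ) :
    l + |v| * jacobiWeight a b l y ≤ a y / 2 * v ^ 2 + b y := by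
  have ha := h.pos_a y
  have h1 : jacobiWeight a b l y = √(a y) * √(2 * (b y - l)) := by
    rw [jacobiWeight, ← Real.sqrt_mul ha.le]; ring_nf
  have h2 := Real.sq_sqrt ha.le
  have h3 := Real.sq_sqrt (show 0 ≤ 2 * (b y - l) by linarith)
  rw [h1]
  have h4 := sq_nonneg (√(a y) * |v| - √(2 * (b y - l)))
  have h5 : (√(a y) * |v| - √(2 * (b y - l))) ^ 2
      = a y * v ^ 2 - 2 * (|v| * (√(a y) * √(2 * (b y - l)))) + 2 * (b y - l) := by
    rw [sub_sq, mul_pow, h2, h3, sq_abs]; ring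
  linarith

theorem level_add_mean_le (h : IsProfile a b) {l : ℝ} (hl : ∀ y, l ≤ b y) (v : ℝ) :
    l + |v| * jacobiMean a b l ≤ ∫ y in (0 : ℝ)..1, (a y / 2 * v ^ 2 + b y) := by
  have hw := h.continuous_jacobiWeight l
  have := h.cont_a
  have := h.cont_b
  have h1 : l + |v| * jacobiMean a b l
      = ∫ y in (0 : ℝ)..1, (l + |v| * jacobiWeight a b l y) := by
    rw [intervalIntegral.integral_add (by simp)
      ((by fun_prop : Continuous _).intervalIntegrable _ _),
      intervalIntegral.integral_const_mul]
    simp [jacobiMean]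
  rw [h1]
  exact intervalIntegral.integral_mono_on zero_le_one
    ((by fun_prop : Continuous _).intervalIntegrable _ _)
    ((by fun_prop : Continuous _).intervalIntegrable _ _) fun y _ => h.level_add_le (hl y) v

theorem bddAbove (h : IsProfile a b) (v : ℝ) :
    BddAbove (range fun l : {l : ℝ // ∀ y, l ≤ b y} => (l : ℝ) + |v| * jacobiMean a b l) :=
  ⟨_, by rintro _ ⟨l, rfl⟩; exact h.level_add_mean_le l.2 v⟩

theorem le_cellEnergy (h : IsProfile a b) {l : ℝ} (hl : ∀ y, l ≤ b y) (v : ℝ) :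
    l + |v| * jacobiMean a b l ≤ cellEnergy a b v :=
  le_ciSup (h.bddAbove v) (⟨l, hl⟩ : {l : ℝ // ∀ y, l ≤ b y})

theorem cellEnergy_le (h : IsProfile a b) {v C : ℝ}
    (hC : ∀ l, (∀ y, l ≤ b y) → l + |v| * jacobiMean a b l ≤ C) : cellEnergy a b v ≤ C := by
  have : Nonempty {l : ℝ // ∀ y, l ≤ b y} := ⟨⟨0, h.nonneg_b⟩⟩
  exact ciSup_le fun l => hC l.1 l.2

theorem cellEnergy_nonneg (h : IsProfile a b) (v : ℝ) : 0 ≤ cellEnergy a b v :=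
  le_trans (by have := jacobiMean_nonneg a b 0; positivity) (h.le_cellEnergy h.nonneg_b v)

theorem le_cellEnergy_of_forall_le (h : IsProfile a b) {l : ℝ} (hl : ∀ y, l ≤ b y) (v : ℝ) :
    l ≤ cellEnergy a b v :=
  le_trans (by have := jacobiMean_nonneg a b l; nlinarith [abs_nonneg v]) (h.le_cellEnergy hl v)

theorem cellEnergy_zero (h : IsProfile a b) {z : ℝ} (hz : ∀ y, b z ≤ b y) :
    cellEnergy a b 0 = b z := by
  apply le_antisymm
  · exact h.cellEnergy_le fun l hl => by simpa using hl z
  · exact h.le_cellEnergy_of_forall_le hz 0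

theorem cellEnergy_zero_le (h : IsProfile a b) (v : ℝ) : cellEnergy a b 0 ≤ cellEnergy a b v := by
  obtain ⟨z, hz⟩ := exists_forall_ge_of_periodic h.cont_b h.per_b
  rw [h.cellEnergy_zero hz]
  exact h.le_cellEnergy_of_forall_le hz v

theorem convexOn_cellEnergy (h : IsProfile a b) : ConvexOn ℝ univ (cellEnergy a b) := by
  refine ⟨convex_univ, fun x _ y _ s t hs ht hst => h.cellEnergy_le fun l hl => ?_⟩
  have hx := h.le_cellEnergy hl x
  have hy := h.le_cellEnergy hl y
  have h0 := jacobiMean_nonneg a b l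
  have h1 : |s * x + t * y| ≤ s * |x| + t * |y| := by
    refine (abs_add_le _ _).trans ?_
    rw [abs_mul, abs_mul, abs_of_nonneg hs, abs_of_nonneg ht]
  simp only [smul_eq_mul]
  calc l + |s * x + t * y| * jacobiMean a b l
      ≤ l + (s * |x| + t * |y|) * jacobiMean a b l := by gcongr
    _ = s * (l + |x| * jacobiMean a b l) + t * (l + |y| * jacobiMean a b l) := by
        linear_combination (-l) * hst
    _ ≤ _ := by gcongr

theorem continuous_cellEnergy (h : IsProfile a b) : Continuous (cellEnergy a b) :=
  continuousOn_univ.1 (h.convexOn_cellEnergy.continuousOn isOpen_univ)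

/-- Comparison of effective Lagrangians. The levels correspond by `l' = (1 + k) * l + k`. -/
theorem cellEnergy_le_of_le {a' b' : ℝ → ℝ} (h : IsProfile a b) (h' : IsProfile a' b') {k : ℝ}
    (hk : 0 ≤ k) (ha : ∀ y, a' y ≤ (1 + k) * a y) (hb : ∀ y, b' y ≤ (1 + k) * b y + k) (v : ℝ) :
    cellEnergy a' b' v ≤ (1 + k) * cellEnergy a b v + k := by
  refine h'.cellEnergy_le fun l' hl' => ?_
  obtain ⟨l, rfl⟩ : ∃ l, l' = (1 + k) * l + k := ⟨(l' - k) / (1 + k), by field_simp; ring⟩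
  have hl : ∀ y, l ≤ b y := fun y => by
    have h1 := (hl' y).trans (hb y)
    have h2 : (1 + k) * l ≤ (1 + k) * b y := by linarith
    exact le_of_mul_le_mul_left h2 (by linarith)
  have hw : ∀ y, jacobiWeight a' b' ((1 + k) * l + k) y ≤ (1 + k) * jacobiWeight a b l y := by
    intro y
    have h1 : b' y - ((1 + k) * l + k) ≤ (1 + k) * (b y - l) := by linarith [hb y]
    have h2 : 0 ≤ b' y - ((1 + k) * l + k) := by linarith [hl' y]
    have h3 := (h'.pos_a y).le
    have h4 := (h.pos_a y).le
    rw [jacobiWeight, jacobiWeight]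
    calc √(2 * a' y * (b' y - ((1 + k) * l + k)))
        ≤ √(2 * ((1 + k) * a y) * ((1 + k) * (b y - l))) := by
          have := ha y
          gcongr
      _ = √((1 + k) ^ 2 * (2 * a y * (b y - l))) := by ring_nf
      _ = _ := by rw [Real.sqrt_mul (by positivity), Real.sqrt_sq (by positivity)]
  have hm : jacobiMean a' b' ((1 + k) * l + k) ≤ (1 + k) * jacobiMean a b l := by
    rw [jacobiMean, jacobiMean, ← intervalIntegral.integral_const_mul]
    have := h.continuous_jacobiWeight l
    exact intervalIntegral.integral_mono_on zero_le_one
      ((h'.continuous_jacobiWeight _).intervalIntegrable _ _)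
      ((by fun_prop : Continuous _).intervalIntegrable _ _) fun y _ => hw y
  calc (1 + k) * l + k + |v| * jacobiMean a' b' ((1 + k) * l + k)
      ≤ (1 + k) * l + k + |v| * ((1 + k) * jacobiMean a b l) := by gcongr
    _ = (1 + k) * (l + |v| * jacobiMean a b l) + k := by ring
    _ ≤ _ := by
        have := h.le_cellEnergy hl v
        gcongr

end IsProfile

/-- The speed of the extremals at level `l`: the solution `p` of `a / 2 * p ^ 2 = b - l`. -/
noncomputable def cellSpeed (a b : ℝ → ℝ) (l y : ℝ) : ℝ := √(2 * (b y - l) / a y)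

/-- The time in which extremals at level `l` cross the unit cell. -/
noncomputable def crossingTime (a b : ℝ → ℝ) (l : ℝ) : ℝ :=
  ∫ y in (0 : ℝ)..1, (cellSpeed a b l y)⁻¹

namespace IsProfile

variable {a b : ℝ → ℝ}

theorem continuous_cellSpeed (h : IsProfile a b) (l : ℝ) : Continuous (cellSpeed a b l) :=
  Real.continuous_sqrt.comp
    ((by have := h.cont_b; fun_prop : Continuous fun y => 2 * (b y - l)).div h.cont_a
      fun y => (h.pos_a y).ne')

theorem periodic_cellSpeed (h : IsProfile a b) (l : ℝ) :
    Function.Periodic (cellSpeed a b l) 1 := fun y => by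
  simp only [cellSpeed, h.per_a y, h.per_b y]

theorem cellSpeed_pos (h : IsProfile a b) {l y : ℝ} (hl : l < b y) : 0 < cellSpeed a b l y :=
  Real.sqrt_pos.2 (div_pos (by linarith) (h.pos_a y))

/-- Extremals at level `l` attain equality in Young's inequality. -/
theorem level_add_cellSpeed (h : IsProfile a b) {l y : ℝ} (hl : l ≤ b y) :
    a y / 2 * cellSpeed a b l y ^ 2 + b y
      = l + cellSpeed a b l y * jacobiWeight a b l y := by
  have ha := h.pos_a y
  have h0 : 0 ≤ 2 * (b y - l) := by linarith
  rw [cellSpeed, jacobiWeight, ← Real.sqrt_mul (by positivity), Real.sq_sqrt (by positivity)]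
  have : 2 * (b y - l) / a y * (2 * a y * (b y - l)) = (2 * (b y - l)) ^ 2 := by
    field_simp
  rw [this, Real.sqrt_sq h0]
  field_simp
  ring

/-- The levels used for near-optimal curves of mean velocity `v`: an extremal at level `l` is
slightly too fast, and waiting at a minimum of `b` for the remaining time costs at most `η` more than
`l` per unit time. The level is found by the intermediate value theorem. -/
theorem exists_level (h : IsProfile a b) {z : ℝ} (hz : ∀ y, b z ≤ b y) (v : ℝ) {η : ℝ}
    (hη : 0 < η) :
    ∃ l < b z, 0 < 1 - |v| * crossingTime a b l ∧
      (1 - |v| * crossingTime a b l) * (b z - l) ≤ η := by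
  obtain ⟨A, hA0, hA⟩ := exists_abs_le_of_periodic h.cont_a h.per_a
  -- On `l ≤ b z - η` the crossing time agrees with an integral depending continuously on `l : ℝ`.
  let F : ℝ → ℝ → ℝ := fun l y => (√(2 * max (b y - l) η / a y))⁻¹
  have hF : Continuous (Function.uncurry F) := by
    have h1 := h.cont_a
    have h2 := h.cont_b
    have h3 : Continuous fun p : ℝ × ℝ => 2 * max (b p.2 - p.1) η / a p.2 :=
      (by fun_prop : Continuous fun p : ℝ × ℝ => 2 * max (b p.2 - p.1) η).div (by fun_prop)
        fun p => (h.pos_a _).ne'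
    refine (Real.continuous_sqrt.comp h3).inv₀ fun p => ?_
    have : 0 < max (b p.2 - p.1) η := lt_max_of_lt_right hη
    have := h.pos_a p.2
    exact (Real.sqrt_pos.2 (by positivity)).ne'
  have hθ : Continuous fun l => ∫ y in (0 : ℝ)..1, F l y :=
    intervalIntegral.continuous_parametric_intervalIntegral_of_continuous' hF 0 1
  have hFθ : ∀ l ≤ b z - η, (∫ y in (0 : ℝ)..1, F l y) = crossingTime a b l := fun l hl => by
    refine intervalIntegral.integral_congr fun y _ => ?_
    have : η ≤ b y - l := by linarith [hz y]
    simp only [F, cellSpeed, max_eq_left this]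
  by_cases hφ : 0 < 1 - |v| * crossingTime a b (b z - η)
  · refine ⟨b z - η, by linarith, hφ, ?_⟩
    have : 0 ≤ crossingTime a b (b z - η) :=
      intervalIntegral.integral_nonneg zero_le_one fun y _ => inv_nonneg.2 (Real.sqrt_nonneg _)
    have : 0 ≤ |v| * crossingTime a b (b z - η) := by positivity
    nlinarith
  · -- At the very low level `b z - s` the extremals need at most half of the available time.
    set s := 2 * A * v ^ 2 + 2 * η with hs
    have hs0 : 0 < s := by positivity
    have hfast : |v| * crossingTime a b (b z - s) ≤ 1 / 2 := by
      have h1 : crossingTime a b (b z - s) ≤ √(A / (2 * s)) := by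
        have : √(A / (2 * s)) = ∫ y in (0 : ℝ)..1, √(A / (2 * s)) := by simp
        rw [this]
        refine intervalIntegral.integral_mono_on zero_le_one ?_ (by simp) fun y _ => ?_
        · refine ((h.continuous_cellSpeed _).inv₀ fun y => ?_).intervalIntegrable _ _
          exact (h.cellSpeed_pos (by linarith [hz y])).ne'
        · rw [cellSpeed, ← Real.sqrt_inv]
          apply Real.sqrt_le_sqrt
          have ha := h.pos_a y
          have : s ≤ b y - (b z - s) := by linarith [hz y]
          have haA := (le_abs_self _).trans (hA y)
          rw [inv_div]
          gcongr
      have h2 : |v| * √(A / (2 * s)) ≤ 1 / 2 := by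
        rw [← Real.sqrt_sq_eq_abs, ← Real.sqrt_mul (sq_nonneg v)]
        apply Real.sqrt_le_iff.2 ⟨by norm_num, ?_⟩
        rw [mul_div_assoc', div_le_iff₀ (by positivity)]
        nlinarith
      exact (mul_le_mul_of_nonneg_left h1 (abs_nonneg v)).trans h2
    let ψ : ℝ → ℝ := fun l => (1 - |v| * ∫ y in (0 : ℝ)..1, F l y) * (b z - l)
    have hψ : Continuous ψ := by fun_prop
    have hs2 : s ≥ 2 * η := by rw [hs]; nlinarith [mul_nonneg hA0.le (sq_nonneg v)]
    have hmem : η ∈ Icc (ψ (b z - η)) (ψ (b z - s)) := by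
      constructor
      · simp only [ψ]
        rw [hFθ _ le_rfl]
        nlinarith
      · simp only [ψ]
        rw [hFθ _ (by linarith)]
        nlinarith
    obtain ⟨l, hl, hlη⟩ := intermediate_value_Icc' (by linarith) hψ.continuousOn hmem
    simp only [ψ] at hlη
    rw [hFθ l hl.2] at hlη
    refine ⟨l, by linarith [hl.2], ?_, hlη.le⟩
    have : 0 < b z - l := by linarith [hl.2]
    exact pos_of_mul_pos_left (hlη ▸ hη) this.le

end IsProfile

/-! ### Oscillating integrals and absolutely continuous curves -/

/-- Averaging of a rapidly oscillating weight, with an error independent of the interval. -/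
theorem exists_abs_integral_oscillating_sub_le {f : ℝ → ℝ} (hf : Continuous f)
    (hp : Function.Periodic f 1) :
    ∃ C, 0 < C ∧ ∀ ε > 0, ∀ x y : ℝ,
      |(∫ z in x..y, f (z / ε)) - (∫ z in (0 : ℝ)..1, f z) * (y - x)| ≤ C * ε := by
  have hint : ∀ s t, IntervalIntegrable f volume s t := fun s t => hf.intervalIntegrable s t
  have hper : Function.Periodic
      (fun x => (∫ z in (0 : ℝ)..x, f z) - (∫ z in (0 : ℝ)..1, f z) * x) 1 := fun x => by
    have h1 := hp.intervalIntegral_add_eq_add 0 x hint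
    simp only [zero_add] at h1
    simp only [h1]
    ring
  have hcont : Continuous fun x => (∫ z in (0 : ℝ)..x, f z) - (∫ z in (0 : ℝ)..1, f z) * x :=
    (intervalIntegral.continuous_primitive hint 0).sub (by fun_prop)
  obtain ⟨C, hC0, hC⟩ := exists_abs_le_of_periodic hcont hper
  refine ⟨2 * C, by positivity, fun ε hε x y => ?_⟩
  have h1 : (∫ z in x..y, f (z / ε)) = ε * ∫ z in x / ε..y / ε, f z := by
    simp [intervalIntegral.integral_comp_div (fun z => f z) hε.ne']
  have h2 : (∫ z in x / ε..y / ε, f z)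
      = (∫ z in (0 : ℝ)..y / ε, f z) - ∫ z in (0 : ℝ)..x / ε, f z :=
    (intervalIntegral.integral_interval_sub_left (hint _ _) (hint _ _)).symm
  have h3 : (∫ z in x..y, f (z / ε)) - (∫ z in (0 : ℝ)..1, f z) * (y - x)
      = ε * (((∫ z in (0 : ℝ)..y / ε, f z) - (∫ z in (0 : ℝ)..1, f z) * (y / ε))
        - ((∫ z in (0 : ℝ)..x / ε, f z) - (∫ z in (0 : ℝ)..1, f z) * (x / ε))) := by
    rw [h1, h2]
    field_simp
    ring
  rw [h3, abs_mul, abs_of_pos hε]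
  have h4 := abs_sub ((∫ z in (0 : ℝ)..y / ε, f z) - (∫ z in (0 : ℝ)..1, f z) * (y / ε))
    ((∫ z in (0 : ℝ)..x / ε, f z) - (∫ z in (0 : ℝ)..1, f z) * (x / ε))
  have h5 := hC (y / ε)
  have h6 := hC (x / ε)
  nlinarith

theorem ofReal_integral_le_lintegral {α : Type*} [MeasurableSpace α] {ν : Measure α} {f : α → ℝ}
    (hf : Integrable f ν) : ENNReal.ofReal (∫ x, f x ∂ν) ≤ ∫⁻ x, ENNReal.ofReal (f x) ∂ν := by
  calc ENNReal.ofReal (∫ x, f x ∂ν) ≤ ENNReal.ofReal (∫ x, max (f x) 0 ∂ν) :=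
        ENNReal.ofReal_le_ofReal (integral_mono hf hf.pos_part fun x => le_max_left _ _)
    _ = ∫⁻ x, ENNReal.ofReal (max (f x) 0) ∂ν :=
        ofReal_integral_eq_lintegral_ofReal hf.pos_part (.of_forall fun x => le_max_right _ _)
    _ = _ := by simp [ENNReal.ofReal_max]

theorem LipschitzWith.comp_absolutelyContinuousOnInterval {G f : ℝ → ℝ} {K : ℝ≥0} {s t : ℝ}
    (hG : LipschitzWith K G) (hf : AbsolutelyContinuousOnInterval f s t) :
    AbsolutelyContinuousOnInterval (G ∘ f) s t := by
  have h0 := (hf.const_mul (K : ℝ))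
  refine squeeze_zero (fun E => Finset.sum_nonneg fun i _ => dist_nonneg) (fun E => ?_) h0
  refine Finset.sum_le_sum fun i _ => (hG.dist_le_mul _ _).trans (le_of_eq ?_)
  simp [Real.dist_eq, ← mul_sub, abs_mul]

/-- The length in the metric `g` of a curve bounds the distance in this metric of its end points. -/
theorem ofReal_abs_integral_le_lintegral_deriv {f g : ℝ → ℝ} {s t : ℝ} (hst : s ≤ t)
    (hf : AbsolutelyContinuousOnInterval f s t) (hg : Continuous g) (hg0 : ∀ x, 0 ≤ g x) {C : ℝ}
    (hC : ∀ x, g x ≤ C) (l : ℝ) :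
    ENNReal.ofReal (l * (t - s) + |∫ x in f s..f t, g x|)
      ≤ ∫⁻ r in Icc s t, ENNReal.ofReal (l + |deriv f r| * g (f r)) := by
  have hint : ∀ x y, IntervalIntegrable g volume x y := fun x y => hg.intervalIntegrable x y
  set G : ℝ → ℝ := fun x => ∫ z in (0 : ℝ)..x, g z with hGdef
  have hGd : ∀ x, HasDerivAt G (g x) x := fun x =>
    intervalIntegral.integral_hasDerivAt_right (hint _ _) (hg.stronglyMeasurableAtFilter _ _)
      hg.continuousAt
  have hC0 : 0 ≤ C := (hg0 0).trans (hC 0)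
  have hGL : LipschitzWith C.toNNReal G :=
    lipschitzWith_of_nnnorm_deriv_le (fun x => (hGd x).differentiableAt) fun x => by
      rw [(hGd x).deriv, ← NNReal.coe_le_coe, coe_nnnorm, Real.norm_of_nonneg (hg0 x),
        Real.coe_toNNReal C hC0]
      exact hC x
  have hGf := hGL.comp_absolutelyContinuousOnInterval hf
  have hD := hGf.intervalIntegrable_deriv
  have hDi : IntegrableOn (deriv (G ∘ f)) (Icc s t) :=
    (intervalIntegrable_iff_integrableOn_Icc_of_le hst).1 hD
  have hFTC : ∫ r in Icc s t, deriv (G ∘ f) r = ∫ x in f s..f t, g x := by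
    rw [integral_Icc_eq_integral_Ioc, ← intervalIntegral.integral_of_le hst,
      hGf.integral_deriv_eq_sub]
    exact intervalIntegral.integral_interval_sub_left (hint _ _) (hint _ _)
  have hae : ∀ᵐ r ∂(volume.restrict (Icc s t)),
      ENNReal.ofReal (l + |deriv (G ∘ f) r|) = ENNReal.ofReal (l + |deriv f r| * g (f r)) := by
    rw [ae_restrict_iff' measurableSet_Icc]
    filter_upwards [hf.ae_differentiableAt] with r hr hrI
    have h1 := (hGd (f r)).comp r (hr (by rwa [uIcc_of_le hst])).hasDerivAt
    rw [h1.deriv, abs_mul, abs_of_nonneg (hg0 _), mul_comm]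
  rw [← lintegral_congr_ae hae]
  have hlc : IntegrableOn (fun _ : ℝ => l) (Icc s t) := by simp
  refine le_trans ?_ (ofReal_integral_le_lintegral (hlc.add hDi.abs))
  refine ENNReal.ofReal_le_ofReal ?_
  rw [← hFTC]
  have h2 := abs_integral_le_integral_abs (f := deriv (G ∘ f)) (μ := volume.restrict (Icc s t))
  have h3 : ∫ r in Icc s t, (l + |deriv (G ∘ f) r|)
      = l * (t - s) + ∫ r in Icc s t, |deriv (G ∘ f) r| := by
    rw [integral_add hlc hDi.abs]
    simp [hst, mul_comm]
  change _ ≤ ∫ r in Icc s t, (l + |deriv (G ∘ f) r|)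
  linarith

/-! ### Periodic Lagrangians depending on a parameter -/

/-- The coefficients of a Lagrangian `a p y / 2 * v ^ 2 + b p y` with a parameter `p`,
jointly continuous, `1`-periodic in `y`, with `b ≥ 0` and with `a` bounded below by `m > 0`. -/
structure IsProfileField {X : Type*} [TopologicalSpace X] (a b : X → ℝ → ℝ) (m : ℝ) : Prop where
  cont_a : Continuous fun p : X × ℝ => a p.1 p.2
  cont_b : Continuous fun p : X × ℝ => b p.1 p.2
  per_a : ∀ p, Function.Periodic (a p) 1
  per_b : ∀ p, Function.Periodic (b p) 1
  pos : 0 < m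
  le_a : ∀ p y, m ≤ a p y
  nonneg_b : ∀ p y, 0 ≤ b p y

theorem exists_mem_Icc_of_periodic {f : ℝ → ℝ} (hp : Function.Periodic f 1) (y : ℝ) :
    Int.fract y ∈ Icc (0 : ℝ) 1 ∧ f (Int.fract y) = f y :=
  ⟨⟨Int.fract_nonneg y, (Int.fract_lt_one y).le⟩, by
    have := hp.sub_zsmul_eq (x := y) ⌊y⌋
    rwa [zsmul_one] at this⟩

theorem eventually_forall_abs_sub_le_of_periodic {X : Type*} [TopologicalSpace X] {f : X → ℝ → ℝ}
    (hf : Continuous fun p : X × ℝ => f p.1 p.2) (hp : ∀ p, Function.Periodic (f p) 1) (p₀ : X)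
    {κ : ℝ} (hκ : 0 < κ) : ∀ᶠ p in 𝓝 p₀, ∀ y, |f p y - f p₀ y| ≤ κ := by
  have h1 : ∀ᶠ p in 𝓝 p₀, ∀ y ∈ Icc (0 : ℝ) 1, |f p y - f p₀ y| < κ := by
    refine isCompact_Icc.eventually_forall_of_forall_eventually fun y _ => ?_
    have hc : Continuous fun z : X × ℝ => |f z.1 z.2 - f p₀ z.2| :=
      (hf.sub (hf.comp (by fun_prop : Continuous fun z : X × ℝ => (p₀, z.2)))).abs
    exact hc.continuousAt.eventually_lt continuousAt_const (by simpa using hκ)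
  filter_upwards [h1] with p h y
  have e1 := exists_mem_Icc_of_periodic (hp p) y
  have e2 := exists_mem_Icc_of_periodic (hp p₀) y
  rw [← e1.2, ← e2.2]
  exact (h _ e1.1).le

theorem exists_forall_abs_sub_le_of_periodic {f : ℝ → ℝ → ℝ}
    (hf : Continuous fun p : ℝ × ℝ => f p.1 p.2) (hp : ∀ p, Function.Periodic (f p) 1) (K : ℝ)
    {κ : ℝ} (hκ : 0 < κ) : ∃ δ > 0, ∀ q ∈ Icc (-K) K, ∀ q' ∈ Icc (-K) K, |q - q'| ≤ δ →
      ∀ y, |f q y - f q' y| ≤ κ := by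
  have h1 := (isCompact_Icc (a := -K) (b := K)).prod (isCompact_Icc (a := (0 : ℝ)) (b := 1))
    |>.uniformContinuousOn_of_continuous hf.continuousOn
  obtain ⟨δ, hδ, h⟩ := Metric.uniformContinuousOn_iff.1 h1 κ hκ
  refine ⟨δ / 2, by positivity, fun q hq q' hq' hqq y => ?_⟩
  have e1 := exists_mem_Icc_of_periodic (hp q) y
  have e2 := exists_mem_Icc_of_periodic (hp q') y
  rw [← e1.2, ← e2.2]
  refine (h (q, Int.fract y) ⟨hq, e1.1⟩ (q', Int.fract y) ⟨hq', e1.1⟩ ?_).le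
  rw [Prod.dist_eq, Real.dist_eq, dist_self, max_eq_left (abs_nonneg _)]
  linarith

namespace IsProfileField

section Param

variable {X : Type*} [TopologicalSpace X] {a b : X → ℝ → ℝ} {m : ℝ}

theorem profile (h : IsProfileField a b m) (p : X) : IsProfile (a p) (b p) where
  cont_a := h.cont_a.comp (by fun_prop : Continuous fun y : ℝ => (p, y))
  cont_b := h.cont_b.comp (by fun_prop : Continuous fun y : ℝ => (p, y))
  per_a := h.per_a p
  per_b := h.per_b p
  pos_a y := h.pos.trans_le (h.le_a p y)
  nonneg_b := h.nonneg_b p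

theorem le_of_abs_sub_le (h : IsProfileField a b m) {κ : ℝ} (hκ : 0 ≤ κ) {p p' : X} {y : ℝ}
    (ha : |a p y - a p' y| ≤ κ * m) (hb : |b p y - b p' y| ≤ κ) :
    a p y ≤ (1 + κ) * a p' y ∧ b p y ≤ (1 + κ) * b p' y + κ := by
  have h1 := (abs_le.1 ha).2
  have h2 := (abs_le.1 hb).2
  have h3 := mul_le_mul_of_nonneg_left (h.le_a p' y) hκ
  have h4 := mul_nonneg hκ (h.nonneg_b p' y)
  constructor <;> linarith

theorem eventually_le (h : IsProfileField a b m) (p₀ : X) {κ : ℝ} (hκ : 0 < κ) :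
    ∀ᶠ p in 𝓝 p₀, ∀ y, (a p y ≤ (1 + κ) * a p₀ y ∧ b p y ≤ (1 + κ) * b p₀ y + κ) ∧
      (a p₀ y ≤ (1 + κ) * a p y ∧ b p₀ y ≤ (1 + κ) * b p y + κ) := by
  have hm := h.pos
  filter_upwards [eventually_forall_abs_sub_le_of_periodic h.cont_a h.per_a p₀ (mul_pos hκ hm),
    eventually_forall_abs_sub_le_of_periodic h.cont_b h.per_b p₀ hκ] with p h1 h2 y
  exact ⟨h.le_of_abs_sub_le hκ.le (h1 y) (h2 y), h.le_of_abs_sub_le hκ.le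
    (by rw [abs_sub_comm]; exact h1 y) (by rw [abs_sub_comm]; exact h2 y)⟩

/-- Continuity in the velocity comes from convexity, and the comparison `cellEnergy_le_of_le` is
uniform in the velocity. -/
theorem continuous_cellEnergy (h : IsProfileField a b m) :
    Continuous fun p : X × ℝ => cellEnergy (a p.1) (b p.1) p.2 := by
  rw [continuous_iff_continuousAt]
  rintro ⟨p₀, v₀⟩
  rw [Metric.continuousAt_iff']
  intro e he
  set c := cellEnergy (a p₀) (b p₀) v₀
  have hc : 0 ≤ c := (h.profile p₀).cellEnergy_nonneg v₀
  set κ := e / (4 * (c + 2)) with hκdef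
  have hκ : 0 < κ := by positivity
  have hκe : κ * (c + 2) = e / 4 := by rw [hκdef]; field_simp
  have hv : ContinuousAt (fun p : X × ℝ => cellEnergy (a p₀) (b p₀) p.2) (p₀, v₀) :=
    ((h.profile p₀).continuous_cellEnergy.comp continuous_snd).continuousAt
  filter_upwards [Metric.continuousAt_iff'.1 hv (e / 2) (by positivity),
    Metric.continuousAt_iff'.1 hv 1 one_pos,
    continuousAt_fst.eventually (h.eventually_le p₀ hκ)] with p h1 h2 h3
  rw [Real.dist_eq] at h1 h2 ⊢
  have h4 := (h.profile p₀).cellEnergy_le_of_le (h.profile p.1) hκ.le (fun y => (h3 y).1.1)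
    (fun y => (h3 y).1.2) p.2
  have h5 := (h.profile p.1).cellEnergy_le_of_le (h.profile p₀) hκ.le (fun y => (h3 y).2.1)
    (fun y => (h3 y).2.2) p.2
  set d := cellEnergy (a p₀) (b p₀) p.2
  set d' := cellEnergy (a p.1) (b p.1) p.2
  have hd : d ≤ c + 1 := by linarith [(abs_lt.1 h2).2]
  have h6 : κ * (d + 1) ≤ e / 4 := hκe ▸ mul_le_mul_of_nonneg_left (by linarith) hκ.le
  have h7 : d' ≤ d + e / 4 := by linarith
  have h8 : d - e / 4 ≤ d' := by
    by_contra hlt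
    have : (1 + κ) * d' < (1 + κ) * (d - e / 4) := mul_lt_mul_of_pos_left (by linarith) (by linarith)
    nlinarith
  have h9 := abs_lt.1 h1
  exact abs_lt.2 ⟨by linarith, by linarith⟩

end Param

variable {a b : ℝ → ℝ → ℝ} {m : ℝ}

theorem exists_forall_le (h : IsProfileField a b m) (K : ℝ) {κ : ℝ} (hκ : 0 < κ) :
    ∃ δ > 0, ∀ q ∈ Icc (-K) K, ∀ q' ∈ Icc (-K) K, |q - q'| ≤ δ →
      ∀ y, a q y ≤ (1 + κ) * a q' y ∧ b q y ≤ (1 + κ) * b q' y + κ := by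
  obtain ⟨δ₁, hδ₁, h1⟩ :=
    exists_forall_abs_sub_le_of_periodic h.cont_a h.per_a K (mul_pos hκ h.pos)
  obtain ⟨δ₂, hδ₂, h2⟩ := exists_forall_abs_sub_le_of_periodic h.cont_b h.per_b K hκ
  exact ⟨min δ₁ δ₂, lt_min hδ₁ hδ₂, fun q hq q' hq' hqq y => h.le_of_abs_sub_le hκ.le
    (h1 q hq q' hq' (hqq.trans (min_le_left _ _)) y)
    (h2 q hq q' hq' (hqq.trans (min_le_right _ _)) y)⟩

end IsProfileField

/-! ### The lower bound -/

theorem ENNReal.liminf_add_liminf_le {α : Type*} {f : Filter α} {u v : α → ℝ≥0∞} :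
    liminf u f + liminf v f ≤ liminf (fun x => u x + v x) f := by
  rw [liminf_eq_iSup_iInf, liminf_eq_iSup_iInf, liminf_eq_iSup_iInf]
  refine ENNReal.biSup_add_biSup_le' ⟨_, univ_mem⟩ ⟨_, univ_mem⟩ fun s hs t ht => ?_
  refine le_iSup₂_of_le (s ∩ t) (inter_mem hs ht) (le_iInf₂ fun x hx => ?_)
  exact add_le_add (iInf₂_le x hx.1) (iInf₂_le x hx.2)

/-- The oscillating Lagrangian at scale `ε`. -/
noncomputable def oscillatingLagrangian (a b : ℝ → ℝ → ℝ) (ε q v : ℝ) : ℝ≥0∞ :=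
  ENNReal.ofReal (a q (q / ε) / 2 * v ^ 2 + b q (q / ε))

namespace AbsolutelyContinuousOnInterval

open AbsolutelyContinuousOnInterval

/-- A modulus of absolute continuity that depends on the Dirichlet energy only. -/
theorem sum_dist_le {f : ℝ → ℝ} {T m C k : ℝ} (hT : 0 ≤ T)
    (hf : AbsolutelyContinuousOnInterval f 0 T) (hm : 0 < m) (hC : 0 ≤ C) (hk : 0 < k)
    (hE : ∫⁻ r in Icc 0 T, ENNReal.ofReal (m / 2 * deriv f r ^ 2) ≤ ENNReal.ofReal C)
    {E : ℕ × (ℕ → ℝ × ℝ)} (hEd : E ∈ disjWithin 0 T) :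
    ∑ i ∈ Finset.range E.1, dist (f (E.2 i).1) (f (E.2 i).2)
      ≤ k * C + (∑ i ∈ Finset.range E.1, dist (E.2 i).1 (E.2 i).2) / (2 * k * m) := by
  set L : ℝ → ℝ≥0∞ := fun r => ENNReal.ofReal (m / 2 * deriv f r ^ 2) with hL
  have hyoung : ∀ v : ℝ, -(1 / (2 * k * m)) + |v| ≤ k * (m / 2 * v ^ 2) := fun v => by
    have h1 : k * (m / 2 * v ^ 2) - (-(1 / (2 * k * m)) + |v|)
        = (k * m * |v| - 1) ^ 2 / (2 * k * m) := by
      rw [← sq_abs v]; field_simp; ring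
    have h2 : 0 ≤ (k * m * |v| - 1) ^ 2 / (2 * k * m) := by positivity
    linarith
  -- The estimate on one interval: a length estimate with a negative additive constant.
  have hone : ∀ x ∈ uIcc 0 T, ∀ y ∈ uIcc 0 T,
      ENNReal.ofReal (dist (f x) (f y) - dist x y / (2 * k * m))
        ≤ ENNReal.ofReal k * ∫⁻ r in uIoc x y, L r := by
    intro x hx y hy
    wlog hxy : x ≤ y generalizing x y
    · have := this y hy x hx (le_of_not_ge hxy)
      rwa [dist_comm x y, dist_comm (f x), uIoc_comm]
    have hac : AbsolutelyContinuousOnInterval f x y := hf.mono (uIcc_subset_uIcc hx hy)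
    have h1 := ofReal_abs_integral_le_lintegral_deriv hxy hac continuous_const
      (fun _ => zero_le_one) (C := 1) (fun _ => le_rfl) (-(1 / (2 * k * m)))
    rw [uIoc_of_le hxy, ← lintegral_const_mul' _ _ ENNReal.ofReal_ne_top,
      restrict_Ioc_eq_restrict_Icc]
    refine le_trans (le_of_eq ?_) (h1.trans (lintegral_mono fun r => ?_))
    · congr 1
      rw [intervalIntegral.integral_const, smul_eq_mul, mul_one, Real.dist_eq, Real.dist_eq,
        abs_sub_comm x y, abs_of_nonneg (sub_nonneg.2 hxy), abs_sub_comm (f x)]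
      ring
    · rw [hL, ← ENNReal.ofReal_mul hk.le, mul_one]
      exact ENNReal.ofReal_le_ofReal (hyoung _)
  have hdisj := hEd.2
  have hsum : ∑ i ∈ Finset.range E.1, ∫⁻ r in uIoc (E.2 i).1 (E.2 i).2, L r
      ≤ ENNReal.ofReal C := by
    rw [← lintegral_biUnion_finset hdisj fun i _ => measurableSet_uIoc]
    refine (lintegral_mono_set ?_).trans hE
    refine (biUnion_uIoc_subset_of_mem_disjWithin hEd).trans ?_
    rw [uIoc_of_le hT]
    exact Ioc_subset_Icc_self
  have hfin : ∀ i ∈ Finset.range E.1, ∫⁻ r in uIoc (E.2 i).1 (E.2 i).2, L r ≠ ∞ := fun i hi =>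
    ne_top_of_le_ne_top ENNReal.ofReal_ne_top
      ((Finset.single_le_sum (fun _ _ => zero_le) hi).trans hsum)
  have hreal : ∀ i ∈ Finset.range E.1,
      dist (f (E.2 i).1) (f (E.2 i).2) - dist (E.2 i).1 (E.2 i).2 / (2 * k * m)
        ≤ k * (∫⁻ r in uIoc (E.2 i).1 (E.2 i).2, L r).toReal := fun i hi => by
    have h1 := hone _ (hEd.1 i hi).1 _ (hEd.1 i hi).2
    rw [ENNReal.ofReal_le_iff_le_toReal (ENNReal.mul_ne_top ENNReal.ofReal_ne_top (hfin i hi)),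
      ENNReal.toReal_mul, ENNReal.toReal_ofReal hk.le] at h1
    exact h1
  have h2 := Finset.sum_le_sum hreal
  rw [Finset.sum_sub_distrib, ← Finset.sum_div, ← Finset.mul_sum, ← ENNReal.toReal_sum hfin] at h2
  have h3 := ENNReal.toReal_le_of_le_ofReal hC hsum
  have h4 := mul_le_mul_of_nonneg_left h3 hk.le
  linarith

/-- Limits of curves with bounded Dirichlet energy are absolutely continuous. -/
theorem of_frequently {ι : Type*} {F : Filter ι} {U : ι → ℝ → ℝ} {Q : ℝ → ℝ} {T m C : ℝ}
    (hT : 0 ≤ T) (hm : 0 < m) (hC : 0 ≤ C) (hU : ∀ r, Tendsto (fun i => U i r) F (𝓝 (Q r)))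
    (hE : ∃ᶠ i in F, AbsolutelyContinuousOnInterval (U i) 0 T ∧
      ∫⁻ r in Icc 0 T, ENNReal.ofReal (m / 2 * deriv (U i) r ^ 2) ≤ ENNReal.ofReal C) :
    AbsolutelyContinuousOnInterval Q 0 T := by
  have hbound : ∀ k > 0, ∀ E ∈ disjWithin 0 T,
      ∑ i ∈ Finset.range E.1, dist (Q (E.2 i).1) (Q (E.2 i).2)
        ≤ k * C + (∑ i ∈ Finset.range E.1, dist (E.2 i).1 (E.2 i).2) / (2 * k * m) := by
    intro k hk E hEd
    have hlim : Tendsto (fun i => ∑ j ∈ Finset.range E.1, dist (U i (E.2 j).1) (U i (E.2 j).2)) F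
        (𝓝 (∑ j ∈ Finset.range E.1, dist (Q (E.2 j).1) (Q (E.2 j).2))) :=
      tendsto_finsetSum _ fun j _ => (hU _).dist (hU _)
    exact le_of_tendsto_of_frequently hlim
      (hE.mono fun i hi => hi.1.sum_dist_le hT hm hC hk hi.2 hEd)
  rw [absolutelyContinuousOnInterval_iff]
  intro e he
  set k := e / (2 * (C + 1)) with hkdef
  have hk : 0 < k := by positivity
  have hkC : k * (C + 1) = e / 2 := by rw [hkdef]; field_simp
  refine ⟨e * k * m, by positivity, fun E hEd hlen => ?_⟩
  have h1 := hbound k hk E hEd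
  have h2 : (∑ i ∈ Finset.range E.1, dist (E.2 i).1 (E.2 i).2) / (2 * k * m) < e / 2 := by
    rw [div_lt_iff₀ (by positivity)]
    linarith
  linarith

end AbsolutelyContinuousOnInterval

namespace IsProfileField

variable {a b : ℝ → ℝ → ℝ} {m : ℝ}

/-- Near the state `q₀`, the action of a curve is bounded below by its Jacobi length, taken with
frozen coefficients. -/
theorem le_lintegral_of_frozen (h : IsProfileField a b m) {ε κ l q₀ s t : ℝ} (hκ : 0 < κ)
    (hl : ∀ y, l ≤ b q₀ y) (hst : s ≤ t) {f : ℝ → ℝ} (hf : AbsolutelyContinuousOnInterval f s t)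
    (hclose : ∀ r ∈ Icc s t, ∀ y,
      a q₀ y ≤ (1 + κ) * a (f r) y ∧ b q₀ y ≤ (1 + κ) * b (f r) y + κ) :
    ENNReal.ofReal (((l - κ) * (t - s)
        + |∫ z in f s..f t, jacobiWeight (a q₀) (b q₀) l (z / ε)|) / (1 + κ))
      ≤ ∫⁻ r in Icc s t, oscillatingLagrangian a b ε (f r) (deriv f r) := by
  have hp := h.profile q₀
  obtain ⟨C, _, hC⟩ :=
    exists_abs_le_of_periodic (hp.continuous_jacobiWeight l) (hp.periodic_jacobiWeight l)
  have h1 := ofReal_abs_integral_le_lintegral_deriv hst hf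
    (g := fun z => jacobiWeight (a q₀) (b q₀) l (z / ε))
    ((hp.continuous_jacobiWeight l).comp (by fun_prop)) (fun x => jacobiWeight_nonneg _ _ _ _)
    (C := C) (fun x => (le_abs_self _).trans (hC _)) (l - κ)
  have hκ1 : 0 < 1 + κ := by linarith
  rw [ENNReal.ofReal_div_of_pos hκ1]
  refine ENNReal.div_le_of_le_mul' (h1.trans ?_)
  rw [← lintegral_const_mul' _ _ ENNReal.ofReal_ne_top]
  refine setLIntegral_mono' measurableSet_Icc fun r hr => ?_
  rw [oscillatingLagrangian, ← ENNReal.ofReal_mul hκ1.le]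
  refine ENNReal.ofReal_le_ofReal ?_
  have h2 := hp.level_add_le (hl (f r / ε)) (deriv f r)
  have h3 := hclose r hr (f r / ε)
  have h4 := mul_le_mul_of_nonneg_right h3.1 (sq_nonneg (deriv f r))
  linarith [h3.2]

/-- The lower bound on short intervals: the limit inferior of the actions `I ε t` on `[0, t]` grows
at least by the homogenized Jacobi length of the limit curve `Q`. -/
theorem add_le_liminf (h : IsProfileField a b m) {T : ℝ} {U : ℝ → ℝ → ℝ} {Q : ℝ → ℝ}
    (hU : TendstoUniformly U Q (𝓝[>] 0)) {κ l s t : ℝ} (hκ : 0 < κ)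
    (h0s : 0 ≤ s) (hst : s ≤ t) (htT : t ≤ T) {q₀ δ : ℝ} (hl : ∀ y, l ≤ b q₀ y) (hδ : 0 < δ)
    (hQ : ∀ r ∈ Icc s t, |Q r - q₀| ≤ δ)
    (hclose : ∀ q, |q - q₀| < 2 * δ → ∀ y,
      a q₀ y ≤ (1 + κ) * a q y ∧ b q₀ y ≤ (1 + κ) * b q y + κ)
    {I : ℝ → ℝ → ℝ≥0∞}
    (hI : ∀ ε, AbsolutelyContinuousOnInterval (U ε) 0 T → ∀ r, I ε r
      = ∫⁻ r in Icc 0 r, oscillatingLagrangian a b ε (U ε r) (deriv (U ε) r))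
    (hItop : ∀ ε, ¬ AbsolutelyContinuousOnInterval (U ε) 0 T → ∀ r, I ε r = ∞) :
    ENNReal.ofReal (((l - κ) * (t - s) + |jacobiMean (a q₀) (b q₀) l * (Q t - Q s)|) / (1 + κ))
        + liminf (fun ε => I ε s) (𝓝[>] 0)
      ≤ liminf (fun ε => I ε t) (𝓝[>] 0) := by
  have hp := h.profile q₀
  obtain ⟨C, hC0, hC⟩ := exists_abs_integral_oscillating_sub_le
    (hp.continuous_jacobiWeight l) (hp.periodic_jacobiWeight l)
  have hUr : ∀ r, Tendsto (fun ε => U ε r) (𝓝[>] 0) (𝓝 (Q r)) := fun r => hU.tendsto_at r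
  have hosc : Tendsto (fun ε => ∫ z in U ε s..U ε t, jacobiWeight (a q₀) (b q₀) l (z / ε))
      (𝓝[>] 0) (𝓝 (jacobiMean (a q₀) (b q₀) l * (Q t - Q s))) := by
    have h1 : Tendsto (fun ε => jacobiMean (a q₀) (b q₀) l * (U ε t - U ε s)) (𝓝[>] 0)
        (𝓝 (jacobiMean (a q₀) (b q₀) l * (Q t - Q s))) :=
      ((hUr t).sub (hUr s)).const_mul _
    have hε0 : Tendsto (fun ε : ℝ => C * ε) (𝓝[>] 0) (𝓝 0) := by
      have : Tendsto (fun ε : ℝ => C * ε) (𝓝 0) (𝓝 (C * 0)) := tendsto_id.const_mul C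
      rw [mul_zero] at this
      exact this.mono_left nhdsWithin_le_nhds
    have h2 : Tendsto (fun ε => (∫ z in U ε s..U ε t, jacobiWeight (a q₀) (b q₀) l (z / ε))
        - jacobiMean (a q₀) (b q₀) l * (U ε t - U ε s)) (𝓝[>] 0) (𝓝 0) :=
      squeeze_zero_norm' (eventually_mem_nhdsWithin.mono fun ε hε => hC ε hε _ _) hε0
    simpa using h2.add h1
  have hlim := ((hosc.abs.const_add ((l - κ) * (t - s))).div_const (1 + κ))
  rw [← ((ENNReal.continuous_ofReal.tendsto _).comp hlim).liminf_eq]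
  refine ENNReal.liminf_add_liminf_le.trans (liminf_le_liminf ?_)
  filter_upwards [Metric.tendstoUniformly_iff.1 hU δ hδ] with ε hε
  by_cases hac : AbsolutelyContinuousOnInterval (U ε) 0 T
  · have hT : 0 ≤ T := h0s.trans (hst.trans htT)
    have hac' : AbsolutelyContinuousOnInterval (U ε) s t := hac.mono <| by
      rw [uIcc_of_le hst, uIcc_of_le hT]
      exact Icc_subset_Icc h0s htT
    have h1 := h.le_lintegral_of_frozen (ε := ε) hκ hl hst hac' fun r hr => hclose _ <| by
      have h1 := hε r
      have h2 := hQ r hr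
      rw [Real.dist_eq, abs_sub_comm] at h1
      have := abs_sub_le (U ε r) (Q r) q₀
      linarith
    rw [hI ε hac, hI ε hac]
    refine (add_le_add_left h1 _).trans (le_of_eq ?_)
    rw [add_comm, ← restrict_Ioc_eq_restrict_Icc (a := s), ← lintegral_union measurableSet_Ioc,
      Icc_union_Ioc_eq_Icc h0s hst]
    exact disjoint_left.2 fun x hx hx' => (hx.2.trans_lt hx'.1).false
  · simp [hItop ε hac]

/-- The lower bound at one instant of time. -/
theorem cellEnergy_le_deriv (h : IsProfileField a b m) {Q Ψ : ℝ → ℝ} {t : ℝ}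
    (hΨ : DifferentiableAt ℝ Ψ t) (hQ : DifferentiableAt ℝ Q t)
    (hinc : ∀ κ > 0, ∀ l, (∀ y, l ≤ b (Q t) y) → ∀ᶠ s in 𝓝[>] t,
      ((l - κ) * (s - t) + |jacobiMean (a (Q t)) (b (Q t)) l * (Q s - Q t)|) / (1 + κ)
        ≤ Ψ s - Ψ t) :
    cellEnergy (a (Q t)) (b (Q t)) (deriv Q t) ≤ deriv Ψ t := by
  refine (h.profile _).cellEnergy_le fun l hl => ?_
  set J := jacobiMean (a (Q t)) (b (Q t)) l with hJ
  have hslope : ∀ {f : ℝ → ℝ}, DifferentiableAt ℝ f t →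
      Tendsto (fun s => (f s - f t) / (s - t)) (𝓝[>] t) (𝓝 (deriv f t)) := fun hf => by
    have := hf.hasDerivAt.tendsto_slope.mono_left
      (nhdsWithin_mono t fun s (hs : t < s) => hs.ne')
    refine this.congr fun s => ?_
    rw [slope_def_field]
  have hκ : ∀ κ > 0, ((l - κ) + |J * deriv Q t|) / (1 + κ) ≤ deriv Ψ t := fun κ hκ => by
    have h1 : Tendsto (fun s => ((l - κ) + |J * ((Q s - Q t) / (s - t))|) / (1 + κ)) (𝓝[>] t)
        (𝓝 (((l - κ) + |J * deriv Q t|) / (1 + κ))) :=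
      ((((hslope hQ).const_mul J).abs.const_add _).div_const _)
    refine le_of_tendsto_of_tendsto h1 (hslope hΨ) ?_
    filter_upwards [hinc κ hκ l hl, self_mem_nhdsWithin] with s hs hts
    have hpos : 0 < s - t := sub_pos.2 hts
    rw [le_div_iff₀ hpos]
    refine le_of_eq_of_le ?_ hs
    rw [div_mul_eq_mul_div, add_mul, ← abs_of_pos hpos, ← abs_mul, abs_of_pos hpos]
    congr 3
    field_simp
    exact mul_comm _ _
  have hlim : Tendsto (fun κ : ℝ => ((l - κ) + |J * deriv Q t|) / (1 + κ)) (𝓝[>] 0)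
      (𝓝 (((l - 0) + |J * deriv Q t|) / (1 + 0))) := by
    have : ContinuousAt (fun κ : ℝ => ((l - κ) + |J * deriv Q t|) / (1 + κ)) 0 :=
      ContinuousAt.div (by fun_prop) (by fun_prop) (by norm_num)
    exact this.tendsto.mono_left nhdsWithin_le_nhds
  have := le_of_tendsto hlim (eventually_mem_nhdsWithin.mono hκ)
  rw [sub_zero, add_zero, div_one, abs_mul, abs_of_nonneg (jacobiMean_nonneg _ _ _)] at this
  linarith

/-- The liminf inequality for curves parametrized by the real line. The action `I ε r` on `[0, r]` is
`∞` for all `r` if the curve `U ε` is not absolutely continuous. -/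
theorem lintegral_cellEnergy_le_liminf (h : IsProfileField a b m) {T : ℝ} (hT : 0 < T)
    {U : ℝ → ℝ → ℝ} {Q : ℝ → ℝ} (hU : TendstoUniformly U Q (𝓝[>] 0)) (hQc : Continuous Q)
    {I : ℝ → ℝ → ℝ≥0∞}
    (hI : ∀ ε, AbsolutelyContinuousOnInterval (U ε) 0 T → ∀ r, I ε r
      = ∫⁻ r in Icc 0 r, oscillatingLagrangian a b ε (U ε r) (deriv (U ε) r))
    (hItop : ∀ ε, ¬ AbsolutelyContinuousOnInterval (U ε) 0 T → ∀ r, I ε r = ∞)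
    (hfin : liminf (fun ε => I ε T) (𝓝[>] 0) ≠ ∞) :
    AbsolutelyContinuousOnInterval Q 0 T ∧
      ∫⁻ r in Icc 0 T, ENNReal.ofReal (cellEnergy (a (Q r)) (b (Q r)) (deriv Q r))
        ≤ liminf (fun ε => I ε T) (𝓝[>] 0) := by
  set ψ : ℝ → ℝ≥0∞ := fun t => liminf (fun ε => I ε t) (𝓝[>] 0) with hψ
  have hac : AbsolutelyContinuousOnInterval Q 0 T := by
    obtain ⟨C, hC⟩ := ENNReal.lt_iff_exists_nnreal_btwn.1 (lt_top_iff_ne_top.2 hfin)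
    refine .of_frequently hT.le h.pos C.2 (fun r => hU.tendsto_at r)
      ((frequently_lt_of_liminf_lt (by isBoundedDefault) hC.1).mono fun ε hε => ?_)
    have hacε : AbsolutelyContinuousOnInterval (U ε) 0 T := by
      by_contra hn
      rw [hItop ε hn] at hε
      exact not_top_lt hε
    rw [hI ε hacε] at hε
    refine ⟨hacε, le_trans (lintegral_mono fun r => ?_) (hε.le.trans (by simp))⟩
    refine ENNReal.ofReal_le_ofReal ?_
    have h1 := h.le_a (U ε r) (U ε r / ε)
    have h2 := h.nonneg_b (U ε r) (U ε r / ε)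
    nlinarith [mul_le_mul_of_nonneg_right h1 (sq_nonneg (deriv (U ε) r))]
  refine ⟨hac, ?_⟩
  have hIm : ∀ ε, Monotone (I ε) := fun ε s t hst => by
    by_cases hn : AbsolutelyContinuousOnInterval (U ε) 0 T
    · rw [hI ε hn, hI ε hn]
      exact lintegral_mono_set (Icc_subset_Icc_right hst)
    · simp [hItop ε hn]
  have hψm : Monotone ψ := fun s t hst =>
    liminf_le_liminf (.of_forall fun ε => hIm ε hst)
  have hψfin : ∀ t ≤ T, ψ t ≠ ∞ := fun t ht => ne_top_of_le_ne_top hfin (hψm ht)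
  set Ψ : ℝ → ℝ := fun t => (ψ t).toReal with hΨ
  have hΨm : MonotoneOn Ψ (uIcc 0 T) := fun s _ t ht hst => by
    rw [uIcc_of_le hT.le] at ht
    exact ENNReal.toReal_mono (hψfin t ht.2) (hψm hst)
  have hpt : ∀ᵐ r ∂(volume.restrict (Icc 0 T)),
      ENNReal.ofReal (cellEnergy (a (Q r)) (b (Q r)) (deriv Q r))
        ≤ ENNReal.ofReal (deriv Ψ r) := by
    rw [← restrict_Ioo_eq_restrict_Icc, ae_restrict_iff' measurableSet_Ioo]
    filter_upwards [hΨm.ae_differentiableWithinAt_of_mem, hac.ae_differentiableAt]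
      with t h1 h2 ht
    have htI : t ∈ uIcc 0 T := by
      rw [uIcc_of_le hT.le]
      exact Ioo_subset_Icc_self ht
    have hnhds : uIcc 0 T ∈ 𝓝 t := by
      rw [uIcc_of_le hT.le]
      exact Icc_mem_nhds ht.1 ht.2
    refine ENNReal.ofReal_le_ofReal (h.cellEnergy_le_deriv ((h1 htI).differentiableAt hnhds)
      (h2 htI) fun κ hκ l hl => ?_)
    obtain ⟨δ, hδ, hclose⟩ := Metric.eventually_nhds_iff.1 (h.eventually_le (Q t) hκ)
    obtain ⟨ρ, hρ, hQρ⟩ := Metric.continuousAt_iff.1 (hQc.continuousAt (x := t)) (δ / 2)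
      (by positivity)
    have hev : Ioo t (min (t + ρ) T) ∈ 𝓝[>] t :=
      Ioo_mem_nhdsGT (lt_min (by linarith) ht.2)
    filter_upwards [hev] with s hs
    have hsT : s ≤ T := hs.2.le.trans (min_le_right _ _)
    have h3 := h.add_le_liminf hU hκ ht.1.le hs.1.le hsT hl (half_pos hδ)
      (fun r hr => by
        refine (hQρ ?_).le
        rw [Real.dist_eq, abs_of_nonneg (sub_nonneg.2 hr.1)]
        linarith [hr.2, hs.2, min_le_left (t + ρ) T])
      (fun q hq y => (hclose (by rw [Real.dist_eq]; linarith) y).2) hI hItop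
    have h4 : ENNReal.ofReal (((l - κ) * (s - t)
        + |jacobiMean (a (Q t)) (b (Q t)) l * (Q s - Q t)|) / (1 + κ)) ≤ ψ s - ψ t :=
      ENNReal.le_sub_of_add_le_right (hψfin t ht.2.le) h3
    rw [ENNReal.ofReal_le_iff_le_toReal (ne_top_of_le_ne_top (hψfin s hsT) tsub_le_self),
      ENNReal.toReal_sub_of_le (hψm hs.1.le) (hψfin s hsT)] at h4
    exact h4
  have hint := hΨm.intervalIntegrable_deriv
  have hint' : IntegrableOn (deriv Ψ) (Ioo 0 T) :=
    ((intervalIntegrable_iff_integrableOn_Ioo_of_le hT.le).1 hint)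
  have hnonneg : 0 ≤ᵐ[volume.restrict (Ioo 0 T)] deriv Ψ := by
    rw [EventuallyLE, ae_restrict_iff' measurableSet_Ioo]
    refine .of_forall fun t ht => ?_
    have hnhds : uIcc 0 T ∈ 𝓝 t := by
      rw [uIcc_of_le hT.le]
      exact Icc_mem_nhds ht.1 ht.2
    rw [← derivWithin_of_mem_nhds hnhds]
    exact hΨm.derivWithin_nonneg
  have hFTC := hΨm.intervalIntegral_deriv_mem_uIcc
  have hΨ0T : Ψ 0 ≤ Ψ T := hΨm left_mem_uIcc right_mem_uIcc hT.le
  rw [uIcc_of_le (by linarith), mem_Icc, intervalIntegral.integral_of_le hT.le,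
    integral_Ioc_eq_integral_Ioo] at hFTC
  calc ∫⁻ r in Icc 0 T, ENNReal.ofReal (cellEnergy (a (Q r)) (b (Q r)) (deriv Q r))
      ≤ ∫⁻ r in Icc 0 T, ENNReal.ofReal (deriv Ψ r) := lintegral_mono_ae hpt
    _ = ENNReal.ofReal (∫ r in Ioo 0 T, deriv Ψ r) := by
        rw [← restrict_Ioo_eq_restrict_Icc, ofReal_integral_eq_lintegral_ofReal hint' hnonneg]
    _ ≤ ENNReal.ofReal (Ψ T) := by
        refine ENNReal.ofReal_le_ofReal (hFTC.2.trans ?_)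
        have : 0 ≤ Ψ 0 := ENNReal.toReal_nonneg
        linarith
    _ = ψ T := ENNReal.ofReal_toReal hfin

end IsProfileField

/-! ### Recovery curves -/

/-- There is a Lipschitz curve from `x` at time `s` to `y` at time `t` whose distance to the curve
`Q` is at most `ρ` and whose action is at most `C`. -/
def Connects (L : ℝ → ℝ → ℝ≥0∞) (Q : ℝ → ℝ) (ρ s x t y : ℝ) (C : ℝ≥0∞) : Prop :=
  ∃ w : ℝ → ℝ, (∃ K, LipschitzWith K w) ∧ w s = x ∧ w t = y ∧ (∀ r ∈ Icc s t, |w r - Q r| ≤ ρ) ∧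
    ∫⁻ r in Icc s t, L (w r) (deriv w r) ≤ C

namespace Connects

variable {L : ℝ → ℝ → ℝ≥0∞} {Q : ℝ → ℝ} {ρ s x t y t' y' : ℝ} {C C' : ℝ≥0∞}

theorem mono (h : Connects L Q ρ s x t y C) (hC : C ≤ C') : Connects L Q ρ s x t y C' := by
  obtain ⟨w, h1, h2, h3, h4, h5⟩ := h
  exact ⟨w, h1, h2, h3, h4, h5.trans hC⟩

theorem trans (h : Connects L Q ρ s x t y C) (h' : Connects L Q ρ t y t' y' C') (hst : s ≤ t)
    (htt' : t ≤ t') : Connects L Q ρ s x t' y' (C + C') := by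
  obtain ⟨w, ⟨K, hK⟩, hs, ht, hρ, hw⟩ := h
  obtain ⟨w', ⟨K', hK'⟩, hs', ht', hρ', hw'⟩ := h'
  -- Gluing without a case distinction keeps the Lipschitz property evident.
  set f : ℝ → ℝ := fun r => w (min r t) + w' (max r t) - y with hf
  have hl : ∀ r ≤ t, f r = w r := fun r hr => by simp [hf, min_eq_left hr, max_eq_right hr, hs']
  have hr : ∀ r, t ≤ r → f r = w' r := fun r hr => by simp [hf, min_eq_right hr, max_eq_left hr, ht]
  refine ⟨f, ⟨K + K' + 0, ?_⟩, ?_, ?_, fun r hrI => ?_, ?_⟩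
  · have h1 : LipschitzWith K fun r => w (min r t) := by
      simpa [Function.comp_def] using hK.comp (LipschitzWith.id.min_const t)
    have h2 : LipschitzWith K' fun r => w' (max r t) := by
      simpa [Function.comp_def] using hK'.comp (LipschitzWith.id.max_const t)
    exact (h1.add h2).sub (LipschitzWith.const y)
  · rw [hl s hst, hs]
  · rw [hr t' htt', ht']
  · rcases le_total r t with h | h
    · rw [hl r h]
      exact hρ r ⟨hrI.1, h⟩
    · rw [hr r h]
      exact hρ' r ⟨h, hrI.2⟩
  · rw [← Icc_union_Ioc_eq_Icc hst htt', lintegral_union measurableSet_Ioc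
      (disjoint_left.2 fun r h1 h2 => (h1.2.trans_lt h2.1).false), restrict_Ioc_eq_restrict_Icc]
    refine add_le_add (le_of_eq_of_le ?_ hw) (le_of_eq_of_le ?_ hw')
    · rw [← restrict_Ioo_eq_restrict_Icc]
      refine setLIntegral_congr_fun measurableSet_Ioo fun r hr' => ?_
      have : f =ᶠ[𝓝 r] w := by
        filter_upwards [Iio_mem_nhds hr'.2] with r' h' using hl r' (le_of_lt h')
      simp only [this.deriv_eq, this.eq_of_nhds]
    · rw [← restrict_Ioo_eq_restrict_Icc]
      refine setLIntegral_congr_fun measurableSet_Ioo fun r hr' => ?_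
      have : f =ᶠ[𝓝 r] w' := by
        filter_upwards [Ioi_mem_nhds hr'.1] with r' h' using hr r' (le_of_lt h')
      simp only [this.deriv_eq, this.eq_of_nhds]

theorem sum {t x : ℕ → ℝ} {C : ℕ → ℝ≥0∞} (ht : Monotone t) {n : ℕ} (hn : 1 ≤ n)
    (h : ∀ i < n, Connects L Q ρ (t i) (x i) (t (i + 1)) (x (i + 1)) (C i)) :
    Connects L Q ρ (t 0) (x 0) (t n) (x n) (∑ i ∈ Finset.range n, C i) := by
  induction n, hn using Nat.le_induction with
  | base => simpa using h 0 one_pos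
  | succ n hn ih =>
    rw [Finset.sum_range_succ]
    exact (ih fun i hi => h i (hi.trans n.lt_succ_self)).trans (h n n.lt_succ_self)
      (ht (Nat.zero_le n)) (ht n.le_succ)

end Connects

/-- Solutions of the autonomous equation `X' = p X`, by inversion of the travel time. -/
theorem exists_autonomous_flow {p : ℝ → ℝ} (hp : Continuous p) {c C : ℝ} (hc : 0 < c)
    (hpc : ∀ x, c ≤ p x) (hpC : ∀ x, p x ≤ C) (x : ℝ) :
    ∃ X : ℝ → ℝ, X 0 = x ∧ (∀ r, HasDerivAt X (p (X r)) r) ∧ ∀ y, X (∫ z in x..y, (p z)⁻¹) = y := by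
  have hp0 : ∀ y, 0 < p y := fun y => hc.trans_le (hpc y)
  have hpi : Continuous fun y => (p y)⁻¹ := hp.inv₀ fun y => (hp0 y).ne'
  set Θ : ℝ → ℝ := fun y => ∫ z in x..y, (p z)⁻¹ with hΘ
  have hd : ∀ y, HasDerivAt Θ (p y)⁻¹ y := fun y =>
    intervalIntegral.integral_hasDerivAt_right (hpi.intervalIntegrable _ _)
      (hpi.stronglyMeasurableAtFilter _ _) hpi.continuousAt
  have hdiff : Differentiable ℝ Θ := fun y => (hd y).differentiableAt
  have hmono : StrictMono Θ := strictMono_of_deriv_pos fun y => by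
    rw [(hd y).deriv]
    exact inv_pos.2 (hp0 y)
  have hC : 0 < C := (hp0 0).trans_le (hpC 0)
  have hgrow : ∀ u v, u ≤ v → C⁻¹ * (v - u) ≤ Θ v - Θ u := fun u v huv =>
    mul_sub_le_image_sub_of_le_deriv hdiff (fun y => by
      rw [(hd y).deriv]
      exact inv_anti₀ (hp0 y) (hpC y)) huv
  have hΘx : Θ x = 0 := by simp [hΘ]
  have htop : Tendsto Θ atTop atTop := by
    refine tendsto_atTop_mono' _ ((eventually_ge_atTop x).mono fun y hy => ?_)
      ((tendsto_id.atTop_add (tendsto_const_nhds (x := -x))).const_mul_atTop (inv_pos.2 hC))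
    have := hgrow x y hy
    simp only [id_eq]
    linarith
  have hbot : Tendsto Θ atBot atBot := by
    refine tendsto_atBot_mono' _ ((eventually_le_atBot x).mono fun y hy => ?_)
      ((tendsto_id.atBot_add (tendsto_const_nhds (x := -x))).const_mul_atBot (inv_pos.2 hC))
    have := hgrow y x hy
    simp only [id_eq]
    linarith
  set e := hmono.orderIsoOfSurjective Θ (hdiff.continuous.surjective htop hbot) with he
  have hleft : ∀ y, e.symm (Θ y) = y := fun y => e.symm_apply_apply y
  have hright : ∀ r, Θ (e.symm r) = r := fun r => e.apply_symm_apply r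
  refine ⟨e.symm, ?_, fun r => ?_, hleft⟩
  · rw [← hΘx, hleft]
  · have := HasDerivAt.of_local_left_inverse (e.symm.continuous.continuousAt (x := r))
      (hd (e.symm r)) (inv_pos.2 (hp0 _)).ne' (.of_forall hright)
    rwa [inv_inv] at this

/-- Travelling from `x` to `y` with the speed `p`: the action of the frozen Lagrangian is `l` times
the travel time plus the length in the metric `g`; `κ` accounts for the freezing. -/
theorem Connects.travel {L : ℝ → ℝ → ℝ≥0∞} {Q p g : ℝ → ℝ} {ρ c C l κ s x y : ℝ}
    (hp : Continuous p) (hc : 0 < c) (hpc : ∀ x, c ≤ p x) (hpC : ∀ x, p x ≤ C) (hg : Continuous g)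
    (hκ : 0 ≤ κ) (hpos : ∀ w, 0 ≤ l + p w * g w)
    (hL : ∀ w ∈ uIcc x y, ∀ v, |v| = p w →
      L w v ≤ ENNReal.ofReal ((1 + κ) * (l + p w * g w) + κ))
    (hQ : ∀ r ∈ Icc s (s + |∫ z in x..y, (p z)⁻¹|), ∀ w ∈ uIcc x y, |w - Q r| ≤ ρ) :
    Connects L Q ρ s x (s + |∫ z in x..y, (p z)⁻¹|) y
      (ENNReal.ofReal ((1 + κ) * (l * |∫ z in x..y, (p z)⁻¹| + |∫ z in x..y, g z|)
        + κ * |∫ z in x..y, (p z)⁻¹|)) := by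
  obtain ⟨X, hX0, hXd, hXy⟩ := exists_autonomous_flow hp hc hpc hpC x
  have hp0 : ∀ y, 0 < p y := fun y => hc.trans_le (hpc y)
  set τ := ∫ z in x..y, (p z)⁻¹ with hτ
  have hXm : StrictMono X := strictMono_of_deriv_pos fun r => by
    rw [(hXd r).deriv]
    exact hp0 _
  -- the direction of travel
  obtain ⟨σ, hσ, hστ⟩ : ∃ σ : ℝ, (σ = 1 ∨ σ = -1) ∧ σ * |τ| = τ := by
    rcases le_total 0 τ with h | h
    · exact ⟨1, .inl rfl, by rw [abs_of_nonneg h]; ring⟩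
    · exact ⟨-1, .inr rfl, by rw [abs_of_nonpos h]; ring⟩
  have hσσ : σ * σ = 1 := by rcases hσ with rfl | rfl <;> norm_num
  have hσa : |σ| = 1 := by rcases hσ with rfl | rfl <;> norm_num
  set w : ℝ → ℝ := fun r => X (σ * (r - s)) with hw
  have hwd : ∀ r, HasDerivAt w (σ * p (w r)) r := fun r => by
    have h1 : HasDerivAt (fun r => σ * (r - s)) σ r := by
      simpa using ((hasDerivAt_id r).sub_const s).const_mul σ
    have := (hXd (σ * (r - s))).comp r h1
    rwa [mul_comm] at this
  have hws : w s = x := by simp [hw, hX0]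
  have hwt : w (s + |τ|) = y := by simpa [hw, hστ] using hXy y
  have hwc : Continuous w := continuous_iff_continuousAt.2 fun r => (hwd r).continuousAt
  have hst : s ≤ s + |τ| := by simp
  have hmem : ∀ r ∈ Icc s (s + |τ|), w r ∈ uIcc x y := fun r hr => by
    rcases hσ with rfl | rfl
    · have hm : Monotone w := fun u v huv => hXm.monotone (by linarith)
      rw [← hws, ← hwt]
      exact Icc_subset_uIcc ⟨hm hr.1, hm hr.2⟩
    · have hm : Antitone w := fun u v huv => hXm.monotone (by linarith)
      rw [← hws, ← hwt]
      exact Icc_subset_uIcc' ⟨hm hr.2, hm hr.1⟩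
  have hwabs : ∀ r, |deriv w r| = p (w r) := fun r => by
    rw [(hwd r).deriv, abs_mul, hσa, one_mul, abs_of_pos (hp0 _)]
  refine ⟨w, ⟨C.toNNReal, ?_⟩, hws, hwt, fun r hr => hQ r hr _ (hmem r hr), ?_⟩
  · refine lipschitzWith_of_nnnorm_deriv_le (fun r => (hwd r).differentiableAt) fun r => ?_
    rw [← NNReal.coe_le_coe, coe_nnnorm, Real.norm_eq_abs, hwabs,
      Real.coe_toNNReal C ((hp0 0).le.trans (hpC 0))]
    exact hpC _
  · have hcont : Continuous fun r => (1 + κ) * (l + p (w r) * g (w r)) + κ := by fun_prop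
    have hint : ∫ r in s..(s + |τ|), ((1 + κ) * (l + p (w r) * g (w r)) + κ)
        = (1 + κ) * (l * |τ| + σ * ∫ z in x..y, g z) + κ * |τ| := by
      have h1 : ∫ r in s..(s + |τ|), g (w r) * (σ * p (w r)) = ∫ z in x..y, g z := by
        have := intervalIntegral.integral_comp_mul_deriv (a := s) (b := s + |τ|) (f := w)
          (f' := fun r => σ * p (w r)) (g := g) (fun r _ => hwd r)
          (by fun_prop : Continuous fun r => σ * p (w r)).continuousOn hg
        rw [hws, hwt] at this
        exact this
      have h2 : ∀ r, (1 + κ) * (l + p (w r) * g (w r)) + κ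
          = ((1 + κ) * l + κ) + ((1 + κ) * σ) * (g (w r) * (σ * p (w r))) := fun r => by
        linear_combination (-(1 + κ) * p (w r) * g (w r)) * hσσ
      simp_rw [h2]
      rw [intervalIntegral.integral_add (by simp)
        ((by fun_prop : Continuous _).intervalIntegrable _ _),
        intervalIntegral.integral_const_mul, h1]
      simp
      ring
    have hle : σ * ∫ z in x..y, g z ≤ |∫ z in x..y, g z| := by
      refine (le_abs_self _).trans ?_
      rw [abs_mul, hσa, one_mul]
    calc ∫⁻ r in Icc s (s + |τ|), L (w r) (deriv w r)
        ≤ ∫⁻ r in Icc s (s + |τ|), ENNReal.ofReal ((1 + κ) * (l + p (w r) * g (w r)) + κ) :=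
          setLIntegral_mono' measurableSet_Icc fun r hr => hL _ (hmem r hr) _ (hwabs r)
      _ = ENNReal.ofReal (∫ r in s..(s + |τ|), ((1 + κ) * (l + p (w r) * g (w r)) + κ)) := by
          rw [intervalIntegral.integral_of_le hst, ← integral_Icc_eq_integral_Ioc,
            ofReal_integral_eq_lintegral_ofReal hcont.integrableOn_Icc]
          refine .of_forall fun r => ?_
          have := hpos (w r)
          simp only [Pi.zero_apply]
          positivity
      _ ≤ _ := by
          rw [hint]
          gcongr

/-- Waiting at a point. -/
theorem Connects.wait {L : ℝ → ℝ → ℝ≥0∞} {Q : ℝ → ℝ} {ρ s t x c : ℝ} (hc : 0 ≤ c)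
    (hL : L x 0 ≤ ENNReal.ofReal c) (hQ : ∀ r ∈ Icc s t, |x - Q r| ≤ ρ) :
    Connects L Q ρ s x t x (ENNReal.ofReal (c * (t - s))) := by
  refine ⟨fun _ => x, ⟨0, LipschitzWith.const x⟩, rfl, rfl, hQ, ?_⟩
  simp only [deriv_const', lintegral_const, Measure.restrict_apply_univ, Real.volume_Icc]
  rw [ENNReal.ofReal_mul hc]
  gcongr

theorem mul_abs_integral_add_nonneg {f g : ℝ → ℝ} {l x y : ℝ} (hf : Continuous f)
    (hg : Continuous g) (hf0 : ∀ z, 0 ≤ f z) (hg0 : ∀ z, 0 ≤ g z) (hfg : ∀ z, 0 ≤ l * f z + g z) :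
    0 ≤ l * |∫ z in x..y, f z| + |∫ z in x..y, g z| := by
  wlog hxy : x ≤ y generalizing x y
  · rw [intervalIntegral.integral_symm, abs_neg, intervalIntegral.integral_symm y x, abs_neg]
    exact this (le_of_not_ge hxy)
  rw [abs_of_nonneg (intervalIntegral.integral_nonneg hxy fun z _ => hf0 z),
    abs_of_nonneg (intervalIntegral.integral_nonneg hxy fun z _ => hg0 z),
    ← intervalIntegral.integral_const_mul, ← intervalIntegral.integral_add
      ((hf.const_mul l).intervalIntegrable _ _) (hg.intervalIntegrable _ _)]
  exact intervalIntegral.integral_nonneg hxy fun z _ => hfg z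

namespace IsProfileField

variable {a b : ℝ → ℝ → ℝ} {m : ℝ}

/-- Near-optimal curves of the cell problem with frozen coefficients: wait at a minimum `z` of the
potential for the excess time, then travel along an extremal of the level given by
`IsProfile.exists_level`. -/
theorem exists_connects (h : IsProfileField a b m) {κ q₀ δ : ℝ} (hκ : 0 ≤ κ)
    (hclose : ∀ q, |q - q₀| ≤ δ → ∀ y,
      a q y ≤ (1 + κ) * a q₀ y ∧ b q y ≤ (1 + κ) * b q₀ y + κ)
    {z : ℝ} (hz : ∀ y, b q₀ z ≤ b q₀ y) {s t : ℝ} (hst : s < t) (Δ : ℝ) {η : ℝ} (hη : 0 < η)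
    {Q : ℝ → ℝ} (hQ : ∀ r ∈ Icc s t, |Q r - q₀| ≤ δ) :
    ∃ d > 0, ∀ ε, 0 < ε → ε ≤ d → ∀ x y : ℝ, b q₀ (x / ε) = b q₀ z → |y - x - Δ| ≤ d →
      |x - q₀| ≤ δ → |y - q₀| ≤ δ →
      Connects (oscillatingLagrangian a b ε) Q (2 * δ) s x t y
        (ENNReal.ofReal ((1 + κ) *
          ((t - s) * cellEnergy (a q₀) (b q₀) (Δ / (t - s)) + η) + κ * (t - s))) := by
  have hp := h.profile q₀
  set T := t - s with hT
  have hT0 : 0 < T := sub_pos.2 hst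
  obtain ⟨l, hlz, hφ0, hφη⟩ := hp.exists_level hz (Δ / T) (η := η / (2 * T)) (by positivity)
  set β := b q₀ z with hβ
  set θ := crossingTime (a q₀) (b q₀) l with hθ
  set J := jacobiMean (a q₀) (b q₀) l with hJ
  have hlb : ∀ y, l < b q₀ y := fun y => hlz.trans_le (hz y)
  have hJ0 : 0 ≤ J := jacobiMean_nonneg _ _ _
  have hspos : ∀ y, 0 < cellSpeed (a q₀) (b q₀) l y := fun y => hp.cellSpeed_pos (hlb y)
  have hθ0 : 0 ≤ θ :=
    intervalIntegral.integral_nonneg zero_le_one fun y _ => (inv_pos.2 (hspos y)).le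
  obtain ⟨C₁, hC₁, hosc₁⟩ := exists_abs_integral_oscillating_sub_le
    (hp.continuous_jacobiWeight l) (hp.periodic_jacobiWeight l)
  obtain ⟨C₂, hC₂, hosc₂⟩ := exists_abs_integral_oscillating_sub_le
    (f := fun y => (cellSpeed (a q₀) (b q₀) l y)⁻¹)
    ((hp.continuous_cellSpeed l).inv₀ fun y => (hspos y).ne')
    (fun y => by simp only [hp.periodic_cellSpeed l y])
  obtain ⟨A, _, hA⟩ := exists_abs_le_of_periodic (hp.continuous_cellSpeed l)
    (hp.periodic_cellSpeed l)
  obtain ⟨y₀, hy₀⟩ := exists_forall_ge_of_periodic (hp.continuous_cellSpeed l)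
    (hp.periodic_cellSpeed l)
  have hle := hp.le_cellEnergy (fun y => (hlb y).le) (Δ / T)
  set e := cellEnergy (a q₀) (b q₀) (Δ / T)
  set φ := 1 - |Δ / T| * θ with hφ
  have hTv : T * |Δ / T| = |Δ| := by
    rw [abs_div, abs_of_pos hT0]; field_simp
  have hTφ : T * φ = T - |Δ| * θ := by rw [hφ, mul_sub, ← mul_assoc, hTv, mul_one]
  have hβl : 0 < β - l := sub_pos.2 hlz
  set D := (β - l) * (C₂ + θ) + J + C₁ with hD
  have hD0 : 0 < D := by positivity
  -- The first bound makes the travel time at most `T`, the second one the excess cost at most `η / 2`.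
  refine ⟨min (T * φ / (C₂ + θ)) (η / (2 * D)), by positivity, fun ε hε hεd x y hx hy hxδ hyδ => ?_⟩
  set d := min (T * φ / (C₂ + θ)) (η / (2 * D)) with hd
  have hd1 : (C₂ + θ) * d ≤ T * φ := by
    have := min_le_left (T * φ / (C₂ + θ)) (η / (2 * D))
    rw [← hd, le_div_iff₀ (by positivity)] at this
    linarith
  have hd2 : D * d ≤ η / 2 := by
    have := min_le_right (T * φ / (C₂ + θ)) (η / (2 * D))
    rw [← hd, le_div_iff₀ (by positivity)] at this
    linarith
  have hxy : |(|y - x| - |Δ|)| ≤ d := (abs_abs_sub_abs_le _ _).trans hy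
  have ho₁ := hosc₁ ε hε x y
  have ho₂ := hosc₂ ε hε x y
  rw [← jacobiMean, ← hJ] at ho₁
  rw [← crossingTime, ← hθ] at ho₂
  set τ := ∫ z in x..y, (cellSpeed (a q₀) (b q₀) l (z / ε))⁻¹ with hτ
  set ℓ := ∫ z in x..y, jacobiWeight (a q₀) (b q₀) l (z / ε) with hℓ
  have ho₁' : |(|ℓ| - J * |y - x|)| ≤ C₁ * d := by
    have := (abs_abs_sub_abs_le ℓ (J * (y - x))).trans ho₁
    rw [abs_mul, abs_of_nonneg hJ0] at this
    exact this.trans (by gcongr)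
  have ho₂' : |(|τ| - θ * |y - x|)| ≤ C₂ * d := by
    have := (abs_abs_sub_abs_le τ (θ * (y - x))).trans ho₂
    rw [abs_mul, abs_of_nonneg hθ0] at this
    exact this.trans (by gcongr)
  have hθxy : |(θ * |y - x| - θ * |Δ|)| ≤ θ * d := by
    rw [← mul_sub, abs_mul, abs_of_nonneg hθ0]
    gcongr
  have hJxy : J * |y - x| ≤ J * |Δ| + J * d := by
    rw [← mul_add]
    exact mul_le_mul_of_nonneg_left (by linarith [(abs_le.1 hxy).2]) hJ0
  rw [abs_le] at ho₁' ho₂' hθxy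
  have hτT : |τ| ≤ T := by linarith [ho₂'.2, hθxy.2]
  have hwait : T - |τ| ≤ T * φ + (C₂ + θ) * d := by linarith [ho₂'.1, hθxy.1]
  have hkey : β * (T - |τ|) + (l * |τ| + |ℓ|) ≤ T * e + η := by
    have h1 : β * (T - |τ|) + l * |τ| = l * T + (β - l) * (T - |τ|) := by ring
    have h2 := mul_le_mul_of_nonneg_left hwait hβl.le
    have h3 : |ℓ| ≤ J * |Δ| + J * d + C₁ * d := by linarith [ho₁'.2]
    have h4 : T * (φ * (β - l)) ≤ η / 2 := by
      have := mul_le_mul_of_nonneg_left hφη hT0.le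
      have h5 : T * (η / (2 * T)) = η / 2 := by field_simp
      linarith
    have h5 := mul_le_mul_of_nonneg_left hle hT0.le
    rw [mul_add, ← mul_assoc, hTv] at h5
    have h6 : (β - l) * ((C₂ + θ) * d) + J * d + C₁ * d = D * d := by rw [hD]; ring
    linarith
  have hmem : ∀ w ∈ uIcc x y, |w - q₀| ≤ δ := fun w hw => by
    have h1 : uIcc x y ⊆ Icc (q₀ - δ) (q₀ + δ) :=
      uIcc_subset_Icc (by rw [abs_le] at hxδ; constructor <;> linarith)
        (by rw [abs_le] at hyδ; constructor <;> linarith)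
    have h2 := h1 hw
    exact abs_le.2 ⟨by linarith [h2.1], by linarith [h2.2]⟩
  have hnear : ∀ r ∈ Icc s t, ∀ w ∈ uIcc x y, |w - Q r| ≤ 2 * δ := fun r hr w hw => by
    have h1 := abs_sub_le w q₀ (Q r)
    rw [abs_sub_comm q₀] at h1
    linarith [hmem w hw, hQ r hr]
  have hcw : Continuous fun z => jacobiWeight (a q₀) (b q₀) l (z / ε) :=
    (hp.continuous_jacobiWeight l).comp (by fun_prop)
  have hcs : Continuous fun z => cellSpeed (a q₀) (b q₀) l (z / ε) :=
    (hp.continuous_cellSpeed l).comp (by fun_prop)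
  have hW : Connects (oscillatingLagrangian a b ε) Q (2 * δ) s x (t - |τ|) x
      (ENNReal.ofReal (((1 + κ) * β + κ) * (t - |τ| - s))) := by
    have hβ0 : 0 ≤ β := h.nonneg_b _ _
    refine .wait (by positivity) (ENNReal.ofReal_le_ofReal ?_) fun r hr =>
      hnear r ⟨hr.1, hr.2.trans (by simp)⟩ x left_mem_uIcc
    have := (hclose x hxδ (x / ε)).2
    rw [hx] at this
    simpa using this
  have hG : Connects (oscillatingLagrangian a b ε) Q (2 * δ) (t - |τ|) x (t - |τ| + |τ|) y
      (ENNReal.ofReal ((1 + κ) * (l * |τ| + |ℓ|) + κ * |τ|)) := by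
    have heq : ∀ w, a q₀ (w / ε) / 2 * cellSpeed (a q₀) (b q₀) l (w / ε) ^ 2 + b q₀ (w / ε)
        = l + cellSpeed (a q₀) (b q₀) l (w / ε) * jacobiWeight (a q₀) (b q₀) l (w / ε) :=
      fun w => hp.level_add_cellSpeed (hlb _).le
    refine .travel hcs (hspos y₀) (fun w => hy₀ _) (fun w => (le_abs_self _).trans (hA _)) hcw hκ
      (fun w => ?_) (fun w hw v hv => ENNReal.ofReal_le_ofReal ?_) fun r hr => ?_
    · rw [← heq]
      have := (hp.pos_a (w / ε)).le
      have := hp.nonneg_b (w / ε)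
      positivity
    · have h1 := hclose w (hmem w hw) (w / ε)
      have h2 := mul_le_mul_of_nonneg_right h1.1 (sq_nonneg v)
      rw [← heq, ← hv, sq_abs]
      linarith [h1.2]
    · exact hnear r ⟨by linarith [hr.1], by linarith [hr.2]⟩
  rw [sub_add_cancel] at hG
  refine (hW.trans hG (by linarith) (by simp)).mono ?_
  have hβ0 : 0 ≤ β := h.nonneg_b _ _
  have hW0 : 0 ≤ t - |τ| - s := by linarith
  have hℓ0 : 0 ≤ l * |τ| + |ℓ| :=
    mul_abs_integral_add_nonneg (hcs.inv₀ fun z => (hspos _).ne') hcw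
      (fun z => (inv_pos.2 (hspos _)).le) (fun z => jacobiWeight_nonneg _ _ _ _) fun z => by
        have h1 := hspos (z / ε)
        have h2 := hp.pos_a (z / ε)
        have h3 := hp.nonneg_b (z / ε)
        have h4 := hp.level_add_cellSpeed (hlb (z / ε)).le
        have h5 : 0 ≤ l + cellSpeed (a q₀) (b q₀) l (z / ε)
            * jacobiWeight (a q₀) (b q₀) l (z / ε) := by
          rw [← h4]
          positivity
        have h6 := mul_nonneg h5 (inv_pos.2 h1).le
        rwa [add_mul, mul_right_comm, mul_inv_cancel₀ h1.ne', one_mul] at h6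
  rw [← ENNReal.ofReal_add (by positivity) (by positivity)]
  refine ENNReal.ofReal_le_ofReal ?_
  have h1 : t - |τ| - s = T - |τ| := by rw [hT]; ring
  have h2 := mul_le_mul_of_nonneg_left hkey (show 0 ≤ 1 + κ by linarith)
  rw [h1]
  linarith

/-- Jensen's inequality on short intervals, with the coefficients frozen at `q₀`. -/
theorem mul_cellEnergy_le (h : IsProfileField a b m) {κ q₀ s t : ℝ} (hκ : 0 ≤ κ) (hst : s < t)
    {Q : ℝ → ℝ} (hac : AbsolutelyContinuousOnInterval Q s t)
    (hclose : ∀ r ∈ Icc s t, ∀ y,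
      a q₀ y ≤ (1 + κ) * a (Q r) y ∧ b q₀ y ≤ (1 + κ) * b (Q r) y + κ)
    (hfin : ∫⁻ r in Ioc s t, ENNReal.ofReal (cellEnergy (a (Q r)) (b (Q r)) (deriv Q r)) ≠ ∞) :
    (t - s) * cellEnergy (a q₀) (b q₀) ((Q t - Q s) / (t - s))
      ≤ (1 + κ) * (∫⁻ r in Ioc s t,
          ENNReal.ofReal (cellEnergy (a (Q r)) (b (Q r)) (deriv Q r))).toReal + κ * (t - s) := by
  have hp := h.profile q₀
  have hT : 0 < t - s := sub_pos.2 hst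
  set A := ∫⁻ r in Ioc s t, ENNReal.ofReal (cellEnergy (a (Q r)) (b (Q r)) (deriv Q r)) with hA
  rw [mul_comm, ← le_div_iff₀ hT]
  refine hp.cellEnergy_le fun l hl => ?_
  set J := jacobiMean (a q₀) (b q₀) l with hJ
  have hJ0 : 0 ≤ J := jacobiMean_nonneg _ _ _
  have h1 := ofReal_abs_integral_le_lintegral_deriv hst.le hac continuous_const (fun _ => hJ0)
    (C := J) (fun _ => le_rfl) l
  have h2 : ∫⁻ r in Icc s t, ENNReal.ofReal (l + |deriv Q r| * J)
      ≤ ENNReal.ofReal (1 + κ) * A + ENNReal.ofReal (κ * (t - s)) := by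
    calc ∫⁻ r in Icc s t, ENNReal.ofReal (l + |deriv Q r| * J)
        ≤ ∫⁻ r in Icc s t, (ENNReal.ofReal (1 + κ)
            * ENNReal.ofReal (cellEnergy (a (Q r)) (b (Q r)) (deriv Q r)) + ENNReal.ofReal κ) := by
          refine setLIntegral_mono' measurableSet_Icc fun r hr => ?_
          have hpr := h.profile (Q r)
          rw [← ENNReal.ofReal_mul (by linarith),
            ← ENNReal.ofReal_add (mul_nonneg (by linarith) (hpr.cellEnergy_nonneg _)) hκ]
          refine ENNReal.ofReal_le_ofReal ((hp.le_cellEnergy hl _).trans ?_)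
          exact hpr.cellEnergy_le_of_le hp hκ (fun y => (hclose r hr y).1)
            (fun y => (hclose r hr y).2) _
      _ = _ := by
          rw [lintegral_add_right _ measurable_const,
            lintegral_const_mul' _ _ ENNReal.ofReal_ne_top, ← restrict_Ioc_eq_restrict_Icc, ← hA,
            lintegral_const, Measure.restrict_apply_univ, Real.volume_Ioc, ENNReal.ofReal_mul hκ]
  have h3 := h1.trans h2
  rw [ENNReal.ofReal_le_iff_le_toReal (ENNReal.add_ne_top.2
      ⟨ENNReal.mul_ne_top ENNReal.ofReal_ne_top hfin, ENNReal.ofReal_ne_top⟩),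
    ENNReal.toReal_add (ENNReal.mul_ne_top ENNReal.ofReal_ne_top hfin) ENNReal.ofReal_ne_top,
    ENNReal.toReal_mul, ENNReal.toReal_ofReal (by linarith),
    ENNReal.toReal_ofReal (by positivity)] at h3
  rw [le_div_iff₀ hT]
  refine le_of_eq_of_le ?_ h3
  rw [intervalIntegral.integral_const, smul_eq_mul, abs_mul, abs_of_nonneg hJ0, abs_div,
    abs_of_pos hT]
  field_simp

end IsProfileField

namespace IsProfileField

variable {a b : ℝ → ℝ → ℝ} {m : ℝ}

/-- Near-optimal curves close to `Q`, obtained by solving cell problems on the intervals of a fine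
uniform partition. The nodes are moved, by a distance of order `ε`, to minima of the frozen
potential. -/
theorem eventually_exists_recovery (h : IsProfileField a b m) {T : ℝ} (hT : 0 < T) {Q : ℝ → ℝ}
    (hQ : Continuous Q) (hac : AbsolutelyContinuousOnInterval Q 0 T)
    (hfin : ∫⁻ r in Icc 0 T, ENNReal.ofReal (cellEnergy (a (Q r)) (b (Q r)) (deriv Q r)) ≠ ∞)
    {η : ℝ} (hη : 0 < η) :
    ∀ᶠ ε in 𝓝[>] (0 : ℝ), ∃ w : ℝ → ℝ, (∃ K, LipschitzWith K w) ∧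
      (∀ r ∈ Icc 0 T, |w r - Q r| ≤ η) ∧
      ∫⁻ r in Icc 0 T, oscillatingLagrangian a b ε (w r) (deriv w r)
        ≤ (∫⁻ r in Icc 0 T, ENNReal.ofReal (cellEnergy (a (Q r)) (b (Q r)) (deriv Q r)))
          + ENNReal.ofReal η := by
  set f : ℝ → ℝ≥0∞ := fun r => ENNReal.ofReal (cellEnergy (a (Q r)) (b (Q r)) (deriv Q r)) with hf
  set c := (∫⁻ r in Icc 0 T, f r).toReal with hc
  have hc0 : 0 ≤ c := ENNReal.toReal_nonneg
  obtain ⟨K, hK⟩ := (isCompact_Icc (a := 0) (b := T)).exists_bound_of_continuousOn hQ.continuousOn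
  -- the tolerance for freezing the coefficients
  obtain ⟨κ, hκ, hκ1, hκη⟩ : ∃ κ : ℝ, 0 < κ ∧ κ ≤ 1 ∧ κ * (3 * c + 3 * T) ≤ η / 2 := by
    refine ⟨min 1 (η / (2 * (3 * c + 3 * T))), by positivity, min_le_left _ _, ?_⟩
    have := min_le_right 1 (η / (2 * (3 * c + 3 * T)))
    rw [le_div_iff₀ (by positivity)] at this
    linarith
  obtain ⟨δ₀, hδ₀, hclose⟩ := h.exists_forall_le (K + 1) hκ
  obtain ⟨δ, hδ, hδδ₀, hδ1, hδη⟩ : ∃ δ : ℝ, 0 < δ ∧ δ ≤ δ₀ ∧ δ ≤ 1 ∧ 2 * δ ≤ η :=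
    ⟨min δ₀ (min 1 (η / 2)), by positivity, min_le_left _ _,
      (min_le_right _ _).trans (min_le_left _ _), by
        have := (min_le_right δ₀ (min 1 (η / 2))).trans (min_le_right _ _)
        linarith⟩
  have huc := (isCompact_Icc (a := 0) (b := T)).uniformContinuousOn_of_continuous hQ.continuousOn
  obtain ⟨ρ, hρ, hQρ⟩ := Metric.uniformContinuousOn_iff.1 huc (δ / 2) (by positivity)
  obtain ⟨n, hn⟩ := exists_nat_gt (T / ρ)
  have hn0 : (0 : ℝ) < n := (div_pos hT hρ).trans hn
  have hn1 : 1 ≤ n := by exact_mod_cast hn0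
  set t : ℕ → ℝ := fun i => i * (T / n) with ht
  have hstep : ∀ i, t (i + 1) - t i = T / n := fun i => by simp only [ht]; push_cast; ring
  have hτ : 0 < T / n := by positivity
  have hτρ : T / n < ρ := by
    rw [div_lt_iff₀ hn0, mul_comm]
    rwa [div_lt_iff₀ hρ] at hn
  have htm : Monotone t := monotone_nat_of_le_succ fun i => by linarith [hstep i]
  have ht0 : t 0 = 0 := by simp [ht]
  have htn : t n = T := by simp only [ht]; field_simp
  have htI : ∀ i ≤ n, t i ∈ Icc 0 T := fun i hi => ⟨ht0 ▸ htm (Nat.zero_le i), htn ▸ htm hi⟩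
  have htsub : ∀ i < n, Icc (t i) (t (i + 1)) ⊆ Icc 0 T := fun i hi =>
    Icc_subset_Icc (htI i hi.le).1 (htI (i + 1) hi).2
  have hQi : ∀ i < n, ∀ r ∈ Icc (t i) (t (i + 1)), |Q r - Q (t i)| ≤ δ / 2 := fun i hi r hr => by
    refine (hQρ r (htsub i hi hr) (t i) (htI i hi.le) ?_).le
    rw [Real.dist_eq, abs_of_nonneg (sub_nonneg.2 hr.1)]
    linarith [hr.2, hstep i]
  have hQK : ∀ i ≤ n, ∀ q, |q - Q (t i)| ≤ δ → q ∈ Icc (-(K + 1)) (K + 1) := fun i hi q hq => by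
    have h1 := abs_le.1 (hK _ (htI i hi))
    have h2 := abs_le.1 hq
    constructor <;> linarith [h1.1, h1.2, h2.1, h2.2]
  have hQself : ∀ i ≤ n, Q (t i) ∈ Icc (-(K + 1)) (K + 1) := fun i hi =>
    hQK i hi _ (by simpa using hδ.le)
  choose z hz using fun i => exists_forall_ge_of_periodic
    (h.profile (Q (t i))).cont_b (h.profile (Q (t i))).per_b
  set x : ℝ → ℕ → ℝ := fun ε i => ε * (⌊Q (t i) / ε⌋ + z i) with hx
  have hxlim : ∀ i, Tendsto (fun ε => x ε i) (𝓝[>] 0) (𝓝 (Q (t i))) := fun i => by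
    have hlim : Tendsto (fun ε : ℝ => ε * (1 + |z i|)) (𝓝[>] 0) (𝓝 0) := by
      have : Tendsto (fun ε : ℝ => ε * (1 + |z i|)) (𝓝 0) (𝓝 (0 * (1 + |z i|))) :=
        tendsto_id.mul_const _
      rw [zero_mul] at this
      exact this.mono_left nhdsWithin_le_nhds
    rw [tendsto_iff_norm_sub_tendsto_zero]
    refine squeeze_zero' (.of_forall fun _ => norm_nonneg _)
      (eventually_mem_nhdsWithin.mono fun ε (hε : 0 < ε) => ?_) hlim
    have h1 : x ε i - Q (t i) = ε * (z i - Int.fract (Q (t i) / ε)) := by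
      rw [← Int.self_sub_floor]
      simp only [hx]
      field_simp
      ring
    rw [h1, Real.norm_eq_abs, abs_mul, abs_of_pos hε]
    refine mul_le_mul_of_nonneg_left ((abs_sub _ _).trans ?_) hε.le
    rw [abs_of_nonneg (Int.fract_nonneg (Q (t i) / ε))]
    linarith [Int.fract_lt_one (Q (t i) / ε)]
  set η' := η / (4 * n) with hη'
  have hη'0 : 0 < η' := by positivity
  set α : ℕ → ℝ := fun i => (∫⁻ r in Ioc (t i) (t (i + 1)), f r).toReal with hα
  have hfini : ∀ i < n, ∫⁻ r in Ioc (t i) (t (i + 1)), f r ≠ ∞ := fun i hi =>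
    ne_top_of_le_ne_top hfin (lintegral_mono_set (Ioc_subset_Icc_self.trans (htsub i hi)))
  have hsumα : ∑ i ∈ Finset.range n, α i ≤ c := by
    rw [← ENNReal.toReal_sum fun i hi => hfini i (Finset.mem_range.1 hi),
      ← lintegral_biUnion_finset _ fun i _ => measurableSet_Ioc]
    · refine ENNReal.toReal_mono hfin (lintegral_mono_set (iUnion₂_subset fun i hi => ?_))
      exact Ioc_subset_Icc_self.trans (htsub i (Finset.mem_range.1 hi))
    · exact fun i _ j _ hij => htm.pairwise_disjoint_on_Ioc_succ hij
  set B : ℕ → ℝ := fun i => (1 + κ) * ((1 + κ) * α i + κ * (T / n) + η') + κ * (T / n) with hB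
  have hB0 : ∀ i, 0 ≤ B i := fun i => by
    have : 0 ≤ α i := ENNReal.toReal_nonneg
    positivity
  have hsumB : ∑ i ∈ Finset.range n, B i ≤ c + η := by
    have h1 : ∑ i ∈ Finset.range n, B i
        = (1 + κ) ^ 2 * ∑ i ∈ Finset.range n, α i + (1 + κ) * (κ * T + η / 4) + κ * T := by
      have : ∀ i, B i = (1 + κ) ^ 2 * α i + ((1 + κ) * (κ * (T / n) + η') + κ * (T / n)) :=
        fun i => by simp only [hB]; ring
      simp_rw [this]
      rw [Finset.sum_add_distrib, ← Finset.mul_sum, Finset.sum_const, Finset.card_range,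
        nsmul_eq_mul, hη']
      field_simp
      ring
    rw [h1]
    have h2 := mul_le_mul_of_nonneg_left hsumα (sq_nonneg (1 + κ))
    have h3 : κ * κ ≤ κ := by nlinarith
    have h4 := mul_le_mul_of_nonneg_right h3 hc0
    have h5 := mul_le_mul_of_nonneg_right h3 hT.le
    have h6 := mul_le_mul_of_nonneg_right hκ1 hη.le
    linarith
  have hpiece : ∀ i < n, ∀ᶠ ε in 𝓝[>] (0 : ℝ), Connects (oscillatingLagrangian a b ε) Q (2 * δ)
      (t i) (x ε i) (t (i + 1)) (x ε (i + 1)) (ENNReal.ofReal (B i)) := fun i hi => by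
    have hlt : t i < t (i + 1) := by linarith [hstep i]
    obtain ⟨d, hd, hcon⟩ := h.exists_connects (q₀ := Q (t i)) hκ.le
      (fun q hq y => hclose q (hQK i hi.le q hq) _ (hQself i hi.le) (hq.trans hδδ₀) y)
      (hz i) hlt (Q (t (i + 1)) - Q (t i)) hη'0
      (fun r hr => (hQi i hi r hr).trans (by linarith))
    have hjen := h.mul_cellEnergy_le (q₀ := Q (t i)) hκ.le hlt
      (hac.mono (by
        rw [uIcc_of_le hlt.le, uIcc_of_le hT.le]
        exact htsub i hi))
      (fun r hr y => hclose _ (hQself i hi.le) (Q r)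
        (hQK i hi.le _ ((hQi i hi r hr).trans (by linarith)))
        (by rw [abs_sub_comm]; linarith [hQi i hi r hr]) y) (hfini i hi)
    have e1 := Metric.tendsto_nhds.1 (((hxlim (i + 1)).sub (hxlim i))) d hd
    have e2 := Metric.tendsto_nhds.1 (hxlim i) δ hδ
    have e3 := Metric.tendsto_nhds.1 (hxlim (i + 1)) (δ / 2) (by positivity)
    filter_upwards [e1, e2, e3, Ioc_mem_nhdsGT hd] with ε h1 h2 h3 h4
    rw [Real.dist_eq] at h1 h2 h3
    refine (hcon ε h4.1 h4.2 (x ε i) (x ε (i + 1)) ?_ h1.le h2.le ?_).mono ?_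
    · have : x ε i / ε = z i + ⌊Q (t i) / ε⌋ • (1 : ℝ) := by
        simp only [hx, zsmul_one]
        rw [mul_div_cancel_left₀ _ h4.1.ne', add_comm]
      rw [this]
      exact ((h.per_b (Q (t i))).zsmul _) _
    · have := abs_sub_le (x ε (i + 1)) (Q (t (i + 1))) (Q (t i))
      linarith [hQi i hi (t (i + 1)) (right_mem_Icc.2 hlt.le)]
    · refine ENNReal.ofReal_le_ofReal ?_
      rw [hstep] at hjen ⊢
      simp only [hB]
      have := mul_le_mul_of_nonneg_left (add_le_add_left hjen η') (show 0 ≤ 1 + κ by linarith)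
      linarith
  have hall : ∀ᶠ ε in 𝓝[>] (0 : ℝ), ∀ i ∈ Finset.range n,
      Connects (oscillatingLagrangian a b ε) Q (2 * δ)
        (t i) (x ε i) (t (i + 1)) (x ε (i + 1)) (ENNReal.ofReal (B i)) :=
    (Finset.eventually_all _).2 fun i hi => hpiece i (Finset.mem_range.1 hi)
  filter_upwards [hall] with ε hε
  obtain ⟨w, hw, _, _, hwQ, hwL⟩ :=
    Connects.sum htm hn1 fun i hi => hε i (Finset.mem_range.2 hi)
  rw [ht0, htn] at hwQ hwL
  refine ⟨w, hw, fun r hr => (hwQ r hr).trans hδη, hwL.trans ?_⟩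
  rw [← ENNReal.ofReal_sum_of_nonneg fun i _ => hB0 i, ← ENNReal.ofReal_toReal hfin, ← hc,
    ← ENNReal.ofReal_add hc0 hη.le]
  exact ENNReal.ofReal_le_ofReal hsumB

end IsProfileField

/-! ### Gamma-convergence -/

theorem GammaConverges.unique {X β : Type*} [TopologicalSpace X] [CompleteLinearOrder β]
    {F : ℝ → X → β} {F₀ F₁ : X → β} (h₀ : GammaConverges F F₀) (h₁ : GammaConverges F F₁) :
    F₀ = F₁ := by
  have key : ∀ {G₀ G₁ : X → β}, GammaConverges F G₀ → GammaConverges F G₁ → ∀ x, G₀ x ≤ G₁ x :=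
    fun h h' x => by
      obtain ⟨u, hu, hlim⟩ := h'.2 x
      exact (h.1 x u hu).trans (le_trans liminf_le_limsup hlim)
  exact funext fun x => le_antisymm (key h₀ h₁ x) (key h₁ h₀ x)

theorem gammaConverges_const_of_continuous {X β : Type*} [TopologicalSpace X]
    [CompleteLinearOrder β] [TopologicalSpace β] [OrderTopology β] {f : X → β}
    (hf : Continuous f) : GammaConverges (fun _ => f) f :=
  ⟨fun x _ hu => ((hf.tendsto x).comp hu).liminf_eq.ge,
    fun x => ⟨fun _ => x, tendsto_const_nhds, (tendsto_const_nhds (x := f x)).limsup_eq.le⟩⟩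

/-- A recovery sequence exists as soon as there are points that are optimal up to arbitrarily small
errors. It is chosen to minimize, up to `ε`, the distance plus the excess of the functional. -/
theorem exists_recovery_of_approx {X : Type*} [PseudoEMetricSpace X] {F : ℝ → X → ℝ≥0∞} {c : ℝ≥0∞}
    {x : X} (h : ∀ η : ℝ, 0 < η → ∀ᶠ ε in 𝓝[>] (0 : ℝ),
      ∃ y, edist y x ≤ ENNReal.ofReal η ∧ F ε y ≤ c + ENNReal.ofReal η) :
    ∃ u : ℝ → X, Tendsto u (𝓝[>] 0) (𝓝 x) ∧ limsup (fun ε => F ε (u ε)) (𝓝[>] 0) ≤ c := by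
  set S : ℝ → X → ℝ≥0∞ := fun ε y => edist y x + (F ε y - c) with hS
  have hex : ∀ ε : ℝ, ∃ y, 0 < ε → S ε y ≤ (⨅ y, S ε y) + ENNReal.ofReal ε := fun ε => by
    by_cases hinf : (⨅ y, S ε y) = ∞
    · exact ⟨x, fun _ => by simp [hinf]⟩
    · by_cases hε : 0 < ε
      · have : (⨅ y, S ε y) < (⨅ y, S ε y) + ENNReal.ofReal ε :=
          ENNReal.lt_add_right hinf (ENNReal.ofReal_pos.2 hε).ne'
        obtain ⟨y, hy⟩ := iInf_lt_iff.1 this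
        exact ⟨y, fun _ => hy.le⟩
      · exact ⟨x, fun h => absurd h hε⟩
  choose u hu using hex
  have hS0 : Tendsto (fun ε => S ε (u ε)) (𝓝[>] 0) (𝓝 0) := by
    have hinf : ∀ η : ℝ, 0 < η → ∀ᶠ ε in 𝓝[>] (0 : ℝ), S ε (u ε) ≤ ENNReal.ofReal (3 * η) := by
      intro η hη
      filter_upwards [h η hη, Ioc_mem_nhdsGT hη] with ε ⟨y, hy1, hy2⟩ hε
      calc S ε (u ε) ≤ (⨅ y, S ε y) + ENNReal.ofReal ε := hu ε hε.1
        _ ≤ (ENNReal.ofReal η + ENNReal.ofReal η) + ENNReal.ofReal η := by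
            refine add_le_add ((iInf_le _ y).trans (add_le_add hy1 ?_))
              (ENNReal.ofReal_le_ofReal hε.2)
            exact tsub_le_iff_left.2 hy2
        _ = ENNReal.ofReal (3 * η) := by
            rw [← ENNReal.ofReal_add hη.le hη.le, ← ENNReal.ofReal_add (by positivity) hη.le]
            ring_nf
    rw [ENNReal.tendsto_nhds_zero]
    intro e he
    obtain ⟨η, hη, hηe⟩ : ∃ η : ℝ, 0 < η ∧ ENNReal.ofReal (3 * η) ≤ e := by
      rcases eq_or_ne e ∞ with rfl | hetop
      · exact ⟨1, one_pos, le_top⟩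
      · refine ⟨e.toReal / 3, div_pos (ENNReal.toReal_pos he.ne' hetop) three_pos, ?_⟩
        rw [mul_div_cancel₀ _ three_ne_zero, ENNReal.ofReal_toReal hetop]
    exact (hinf η hη).mono fun ε hε => hε.trans hηe
  refine ⟨u, ?_, ?_⟩
  · rw [tendsto_iff_edist_tendsto_0]
    exact tendsto_of_tendsto_of_tendsto_of_le_of_le tendsto_const_nhds hS0 (fun _ => zero_le)
      fun ε => le_self_add
  · have h1 : Tendsto (fun ε => c + S ε (u ε)) (𝓝[>] 0) (𝓝 c) := by
      simpa using hS0.const_add c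
    rw [← h1.limsup_eq]
    refine limsup_le_limsup (.of_forall fun ε => ?_)
    exact tsub_le_iff_left.1 le_add_self

section Action

variable {T : ℝ} (hT : 0 < T) {L : ℝ → ℝ → ℝ≥0∞}

theorem IccExtend_restrict_apply {w : ℝ → ℝ} {r : ℝ} (hr : r ∈ Icc 0 T) :
    IccExtend hT.le (fun s : Icc (0 : ℝ) T => w s) r = w r := by
  rw [IccExtend_of_mem hT.le _ hr]

theorem actionFunctional_restrict {w : ℝ → ℝ} {K : ℝ≥0} (hw : LipschitzWith K w) :
    actionFunctional hT L ⟨fun s : Icc (0 : ℝ) T => w s, by have := hw.continuous; fun_prop⟩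
      = ∫⁻ r in Icc 0 T, L (w r) (deriv w r) := by
  have hac : AbsolutelyContinuousOnInterval (IccExtend hT.le fun s : Icc (0 : ℝ) T => w s) 0 T := by
    refine LipschitzOnWith.absolutelyContinuousOnInterval (K := K) ?_
    rw [uIcc_of_le hT.le]
    intro r hr r' hr'
    rw [IccExtend_restrict_apply hT hr, IccExtend_restrict_apply hT hr']
    exact hw r r'
  rw [actionFunctional, ContinuousMap.coe_mk, if_pos hac, ← restrict_Ioo_eq_restrict_Icc]
  refine setLIntegral_congr_fun measurableSet_Ioo fun r hr => ?_
  have : IccExtend hT.le (fun s : Icc (0 : ℝ) T => w s) =ᶠ[𝓝 r] w := by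
    filter_upwards [Icc_mem_nhds hr.1 hr.2] with r' hr' using IccExtend_restrict_apply hT hr'
  simp only [this.deriv_eq, this.eq_of_nhds]

end Action

/-- Integrands are ordered if the corresponding action functionals are. The test curves are affine
and short. -/
theorem le_of_actionFunctional_le {L L' : ℝ → ℝ → ℝ≥0∞}
    (hLL' : ∀ (T : ℝ) (hT : 0 < T) (q : C(Icc (0 : ℝ) T, ℝ)),
      actionFunctional hT L q ≤ actionFunctional hT L' q) (q v : ℝ)
    (hL : LowerSemicontinuousAt (fun t => L (q + v * t) v) 0)
    (hL' : UpperSemicontinuousAt (fun t => L' (q + v * t) v) 0) : L q v ≤ L' q v := by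
  by_contra! hlt
  obtain ⟨c, hc, hc₂⟩ := exists_between hlt
  obtain ⟨c', hcc', hc'⟩ := exists_between hc₂
  have e1 := hL c' (by simpa using hc')
  have e2 := hL' c (by simpa using hc)
  obtain ⟨δ, hδ, he⟩ := Metric.eventually_nhds_iff.1 (e1.and e2)
  set T := δ / 2 with hTdef
  have hT : 0 < T := by positivity
  have hlip : LipschitzWith ‖v‖₊ fun t : ℝ => q + v * t := by
    refine LipschitzWith.of_dist_le_mul fun s t => ?_
    simp [Real.dist_eq, ← mul_sub, abs_mul]
  have hder : ∀ t, deriv (fun t : ℝ => q + v * t) t = v := fun t => by simp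
  have h1 := hLL' T hT ⟨fun s : Icc (0 : ℝ) T => q + v * s, by fun_prop⟩
  rw [actionFunctional_restrict hT hlip, actionFunctional_restrict hT hlip] at h1
  simp only [hder] at h1
  have hmem : ∀ t ∈ Icc 0 T, dist t 0 < δ := fun t ht => by
    rw [Real.dist_eq, sub_zero, abs_of_nonneg ht.1]
    linarith [ht.2]
  have h2 : c' * ENNReal.ofReal T ≤ c * ENNReal.ofReal T := by
    calc c' * ENNReal.ofReal T = ∫⁻ t in Icc 0 T, c' := by simp
      _ ≤ ∫⁻ t in Icc 0 T, L (q + v * t) v :=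
          setLIntegral_mono' measurableSet_Icc fun t ht => (he (hmem t ht)).1.le
      _ ≤ _ := h1
      _ ≤ ∫⁻ t in Icc 0 T, c :=
          setLIntegral_mono' measurableSet_Icc fun t ht => (he (hmem t ht)).2.le
      _ = c * ENNReal.ofReal T := by simp
  rw [ENNReal.mul_le_mul_iff_left (ENNReal.ofReal_pos.2 hT).ne' ENNReal.ofReal_ne_top] at h2
  exact absurd h2 (not_le.2 hcc')

/-- Homogenization of one-dimensional periodic Lagrangians. -/
theorem IsProfileField.gammaConverges {a b : ℝ → ℝ → ℝ} {m : ℝ} (h : IsProfileField a b m) {T : ℝ}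
    (hT : 0 < T) :
    GammaConverges (fun ε => actionFunctional hT (oscillatingLagrangian a b ε))
      (actionFunctional hT fun q v => ENNReal.ofReal (cellEnergy (a q) (b q) v)) := by
  classical
  refine ⟨fun x u hu => ?_, fun x => ?_⟩
  · set U : ℝ → ℝ → ℝ := fun ε => IccExtend hT.le (u ε) with hU
    have hunif : TendstoUniformly U (IccExtend hT.le x) (𝓝[>] 0) :=
      (ContinuousMap.tendsto_iff_tendstoUniformly.1 hu).comp (projIcc 0 T hT.le)
    set I : ℝ → ℝ → ℝ≥0∞ := fun ε r => if AbsolutelyContinuousOnInterval (U ε) 0 T then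
      ∫⁻ r in Icc 0 r, oscillatingLagrangian a b ε (U ε r) (deriv (U ε) r) else ∞ with hI
    change _ ≤ liminf (fun ε => I ε T) (𝓝[>] 0)
    by_cases hfin : liminf (fun ε => I ε T) (𝓝[>] 0) = ∞
    · rw [hfin]
      exact le_top
    · have h1 := h.lintegral_cellEnergy_le_liminf hT hunif x.continuous.Icc_extend'
        (fun ε hε r => if_pos hε) (fun ε hε r => if_neg hε) hfin
      rw [actionFunctional, if_pos h1.1]
      exact h1.2
  · by_cases hfin : actionFunctional hT
        (fun q v => ENNReal.ofReal (cellEnergy (a q) (b q) v)) x = ∞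
    · exact ⟨fun _ => x, tendsto_const_nhds, by rw [hfin]; exact le_top⟩
    · refine exists_recovery_of_approx fun η hη => ?_
      have hac : AbsolutelyContinuousOnInterval (IccExtend hT.le x) 0 T := by
        by_contra hn
        exact hfin (if_neg hn)
      have hval : actionFunctional hT (fun q v => ENNReal.ofReal (cellEnergy (a q) (b q) v)) x
          = ∫⁻ t in Icc 0 T, ENNReal.ofReal (cellEnergy (a (IccExtend hT.le x t))
            (b (IccExtend hT.le x t)) (deriv (IccExtend hT.le x) t)) := if_pos hac
      rw [hval] at hfin ⊢
      filter_upwards [h.eventually_exists_recovery hT x.continuous.Icc_extend' hac hfin hη]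
        with ε ⟨w, ⟨K, hw⟩, hwx, hwL⟩
      refine ⟨⟨fun s : Icc (0 : ℝ) T => w s, by have := hw.continuous; fun_prop⟩, ?_, ?_⟩
      · rw [edist_dist]
        refine ENNReal.ofReal_le_ofReal ((ContinuousMap.dist_le hη.le).2 fun s => ?_)
        have := hwx s s.2
        rw [IccExtend_val] at this
        exact this
      · rw [actionFunctional_restrict hT hw]
        exact hwL

/-! ### Quadratic dissipation with a periodic coefficient -/

theorem convexOn_ofReal {f : ℝ → ℝ} (hf : ConvexOn ℝ univ f) (h0 : ∀ v, 0 ≤ f v) :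
    ConvexOn ℝ≥0 univ fun v => ENNReal.ofReal (f v) := by
  refine ⟨convex_univ, fun x _ y _ s t _ _ hst => ?_⟩
  have hst' : (s : ℝ) + t = 1 := by exact_mod_cast hst
  have h1 := hf.2 (mem_univ x) (mem_univ y) (NNReal.coe_nonneg s) (NNReal.coe_nonneg t) hst'
  change ENNReal.ofReal (f ((s : ℝ) * x + (t : ℝ) * y))
    ≤ (s : ℝ≥0∞) * ENNReal.ofReal (f x) + (t : ℝ≥0∞) * ENNReal.ofReal (f y)
  rw [← ENNReal.ofReal_coe_nnreal, ← ENNReal.ofReal_coe_nnreal,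
    ← ENNReal.ofReal_mul (NNReal.coe_nonneg s), ← ENNReal.ofReal_mul (NNReal.coe_nonneg t),
    ← ENNReal.ofReal_add (mul_nonneg (NNReal.coe_nonneg s) (h0 x))
      (mul_nonneg (NNReal.coe_nonneg t) (h0 y))]
  exact ENNReal.ofReal_le_ofReal h1

/-- Fenchel's equality for a potential that is given by `f - f 0`, where `f` lies above the line of
slope `ξ` and touches it. -/
theorem legendreDual_ofReal_sub {f : ℝ → ℝ} {ξ w : ℝ} (hmin : ∀ v, f 0 ≤ f v)
    (hle : ∀ v, ξ * v ≤ f v) (hw : f w = ξ * w) :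
    legendreDual (fun v => ENNReal.ofReal (f v - f 0)) ξ = ENNReal.ofReal (f 0) := by
  have hsub : ∀ v, ENNReal.ofReal (ξ * v) - ENNReal.ofReal (f v - f 0)
      = ENNReal.ofReal (ξ * v - (f v - f 0)) := fun v =>
    (ENNReal.ofReal_sub _ (sub_nonneg.2 (hmin v))).symm
  refine le_antisymm (iSup_le fun v => ?_) (le_iSup_of_le w ?_)
  · simp only [hsub]
    exact ENNReal.ofReal_le_ofReal (by linarith [hle v])
  · simp only [hsub]
    exact ENNReal.ofReal_le_ofReal (by linarith)

theorem legendreDual_quadratic {a : ℝ} (ha : 0 < a) (ξ : ℝ) :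
    legendreDual (fun v => ENNReal.ofReal (a / 2 * v ^ 2)) ξ
      = ENNReal.ofReal (ξ ^ 2 / (2 * a)) := by
  have hsub : ∀ v, ENNReal.ofReal (ξ * v) - ENNReal.ofReal (a / 2 * v ^ 2)
      = ENNReal.ofReal (ξ * v - a / 2 * v ^ 2) := fun v =>
    (ENNReal.ofReal_sub _ (by positivity)).symm
  refine le_antisymm (iSup_le fun v => ?_) (le_iSup_of_le (ξ / a) ?_)
  · simp only [hsub]
    refine ENNReal.ofReal_le_ofReal ?_
    rw [le_div_iff₀ (by positivity)]
    nlinarith [sq_nonneg (ξ - a * v)]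
  · simp only [hsub]
    refine ENNReal.ofReal_le_ofReal (le_of_eq ?_)
    field_simp
    ring

/-- The potential `ξ ^ 2 / (2 * μ y)` on the unit cell: the dual dissipation of the force `ξ`. -/
noncomputable def dualProfile (μ : ℝ → ℝ) (ξ y : ℝ) : ℝ := ξ ^ 2 / (2 * μ y)

/-- The effective dissipation density of the periodic coefficient `μ`: `effectiveDensity μ ξ v` is
`M₀ (v, ξ)`. -/
noncomputable def effectiveDensity (μ : ℝ → ℝ) (ξ v : ℝ) : ℝ := cellEnergy μ (dualProfile μ ξ) v

/-- A periodic dissipation coefficient. -/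
structure IsCoefficient (μ : ℝ → ℝ) : Prop where
  cont : Continuous μ
  per : Function.Periodic μ 1
  pos : ∀ y, 0 < μ y

namespace IsCoefficient

variable {μ : ℝ → ℝ}

theorem profile (h : IsCoefficient μ) (ξ : ℝ) : IsProfile μ (dualProfile μ ξ) where
  cont_a := h.cont
  cont_b := by
    have := h.cont
    exact continuous_const.div (by fun_prop) fun y => by have := h.pos y; positivity
  per_a := h.per
  per_b y := by simp only [dualProfile, h.per y]
  pos_a := h.pos
  nonneg_b y := by
    have := (h.pos y).le
    unfold dualProfile
    positivity

theorem jacobiWeight_eq (h : IsCoefficient μ) (ξ l y : ℝ) :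
    jacobiWeight μ (dualProfile μ ξ) l y = √(ξ ^ 2 - 2 * l * μ y) := by
  have := (h.pos y).ne'
  rw [jacobiWeight, dualProfile]
  congr 1
  field_simp

theorem integral_pos (h : IsCoefficient μ) : 0 < ∫ y in (0 : ℝ)..1, μ y :=
  intervalIntegral.intervalIntegral_pos_of_pos (h.cont.intervalIntegrable _ _) h.pos one_pos

theorem jacobiMean_zero (h : IsCoefficient μ) (ξ : ℝ) :
    jacobiMean μ (dualProfile μ ξ) 0 = |ξ| := by
  simp [jacobiMean, h.jacobiWeight_eq, Real.sqrt_sq_eq_abs]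

theorem abs_mul_abs_le (h : IsCoefficient μ) (ξ v : ℝ) : |v| * |ξ| ≤ effectiveDensity μ ξ v := by
  have := (h.profile ξ).le_cellEnergy (h.profile ξ).nonneg_b v
  rwa [h.jacobiMean_zero, zero_add] at this

theorem young (h : IsCoefficient μ) (ξ v : ℝ) : ξ * v ≤ effectiveDensity μ ξ v := by
  refine le_trans ?_ (h.abs_mul_abs_le ξ v)
  rw [← abs_mul, mul_comm]
  exact le_abs_self _

theorem effectiveDensity_zero (h : IsCoefficient μ) {z : ℝ} (hz : ∀ y, μ y ≤ μ z) (ξ : ℝ) :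
    effectiveDensity μ ξ 0 = ξ ^ 2 / (2 * μ z) :=
  (h.profile ξ).cellEnergy_zero fun y => by
    have := h.pos y
    have := hz y
    unfold dualProfile
    gcongr

theorem exists_forall_le (h : IsCoefficient μ) : ∃ z, ∀ y, μ y ≤ μ z := by
  obtain ⟨z, hz⟩ := exists_forall_ge_of_periodic (f := fun y => -μ y) h.cont.neg fun y => by
    simp only [h.per y]
  exact ⟨z, fun y => neg_le_neg_iff.1 (hz y)⟩

/-- On the graph of the averaged linear law, level `0` is optimal. -/
theorem effectiveDensity_contact (h : IsCoefficient μ) (v : ℝ) :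
    effectiveDensity μ ((∫ y in (0 : ℝ)..1, μ y) * v) v = ((∫ y in (0 : ℝ)..1, μ y) * v) * v := by
  have hμ0 := h.integral_pos
  set μb := ∫ y in (0 : ℝ)..1, μ y with hμb
  refine le_antisymm ((h.profile _).cellEnergy_le fun l hl => ?_) (h.young _ v)
  rcases eq_or_ne v 0 with rfl | hv
  · have := hl 0
    simp only [dualProfile, mul_zero, ne_eq, OfNat.ofNat_ne_zero, not_false_eq_true, zero_pow,
      zero_div] at this
    simpa using this
  · have hξ : 0 < μb * |v| := by positivity
    have hJ : jacobiMean μ (dualProfile μ (μb * v)) l ≤ μb * |v| - l / |v| := by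
      have h1 : μb * |v| - l / |v|
          = ∫ y in (0 : ℝ)..1, (μb * |v| - l / (μb * |v|) * μ y) := by
        rw [intervalIntegral.integral_sub (by simp)
          ((h.cont.const_mul _).intervalIntegrable _ _),
          intervalIntegral.integral_const_mul (l / _), ← hμb,
          intervalIntegral.integral_const, sub_zero, one_smul]
        field_simp
      rw [h1]
      have hc := h.cont
      refine intervalIntegral.integral_mono_on zero_le_one
        (((h.profile _).continuous_jacobiWeight l).intervalIntegrable _ _)
        ((by fun_prop : Continuous _).intervalIntegrable _ _) fun y _ => ?_
      have hly : 2 * l * μ y ≤ (μb * v) ^ 2 := by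
        have h2 := hl y
        have h3 := h.pos y
        rw [dualProfile, le_div_iff₀ (by positivity)] at h2
        linarith
      -- the tangent of the square root
      have hsq : (μb * v) ^ 2 = (μb * |v|) ^ 2 := by rw [mul_pow, mul_pow, sq_abs]
      have hx : l / (μb * |v|) * μ y * (μb * |v|) = l * μ y := by field_simp
      set x := l / (μb * |v|) * μ y
      rw [h.jacobiWeight_eq]
      refine Real.sqrt_le_iff.2 ⟨?_, ?_⟩
      · by_contra! hlt
        nlinarith
      · nlinarith [sq_nonneg x]
    have h2 := mul_le_mul_of_nonneg_left hJ (abs_nonneg v)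
    have h3 : |v| * (μb * |v| - l / |v|) = μb * v * v - l := by
      have : |v| * |v| = v * v := abs_mul_abs_self v
      have h4 : |v| ≠ 0 := abs_ne_zero.2 hv
      field_simp
      linear_combination μb * this
    linarith

/-- Contact forces the averaged linear law: the derivative at level `0` has to vanish. -/
theorem eq_of_effectiveDensity_eq (h : IsCoefficient μ) {ξ v : ℝ}
    (hc : effectiveDensity μ ξ v = ξ * v) : ξ = (∫ y in (0 : ℝ)..1, μ y) * v := by
  have hμ0 := h.integral_pos
  set μb := ∫ y in (0 : ℝ)..1, μ y with hμb
  obtain ⟨z, hz⟩ := h.exists_forall_le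
  obtain ⟨z', hz'⟩ := exists_forall_ge_of_periodic h.cont h.per
  have habs : |v| * |ξ| = ξ * v :=
    le_antisymm (hc ▸ h.abs_mul_abs_le ξ v) (by rw [← abs_mul, mul_comm]; exact le_abs_self _)
  have hlev : ∀ l, (∀ y, l ≤ dualProfile μ ξ y) →
      l + |v| * jacobiMean μ (dualProfile μ ξ) l ≤ |v| * |ξ| := fun l hl =>
    habs ▸ hc ▸ (h.profile ξ).le_cellEnergy hl v
  rcases eq_or_ne ξ 0 with rfl | hξ
  · -- without force, a nonzero velocity costs at least as much as with the minimum of `μ`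
    by_contra hne
    have hv : v ≠ 0 := fun hv => hne (by simp [hv])
    have hz0 := h.pos z'
    set s := v ^ 2 * μ z' with hs
    have hs0 : 0 < s := by positivity
    have h1 := hlev (-s) fun y => by simp [dualProfile, hs0.le]
    have h3 : √2 * (|v| * μ z') ≤ jacobiMean μ (dualProfile μ 0) (-s) := by
      have : √2 * (|v| * μ z') = ∫ y in (0 : ℝ)..1, √2 * (|v| * μ z') := by simp
      rw [this]
      refine intervalIntegral.integral_mono_on zero_le_one (by simp)
        (((h.profile _).continuous_jacobiWeight _).intervalIntegrable _ _) fun y _ => ?_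
      rw [h.jacobiWeight_eq]
      refine Real.le_sqrt_of_sq_le ?_
      rw [mul_pow, mul_pow, sq_abs, Real.sq_sqrt zero_le_two, hs]
      have := mul_le_mul_of_nonneg_left (hz' y) (show 0 ≤ v ^ 2 * μ z' by positivity)
      linarith
    have h4 : 1 < √2 := Real.lt_sqrt_of_sq_lt (by norm_num)
    have h5 := mul_le_mul_of_nonneg_left h3 (abs_nonneg v)
    have h6 : |v| * (√2 * (|v| * μ z')) = √2 * s := by
      rw [hs, ← sq_abs v]; ring
    rw [abs_zero, mul_zero] at h1
    nlinarith
  · have hX : 0 < |ξ| := abs_pos.2 hξ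
    set X := |ξ| with hXdef
    have hXsq : ξ ^ 2 = X ^ 2 := (sq_abs ξ).symm
    have hM := h.pos z
    set D := 2 * μ z ^ 2 / X ^ 3 with hD
    -- a quadratic lower bound for the Jacobi length near level `0`
    have hJ : ∀ l, |l| ≤ X ^ 2 / (2 * μ z) →
        X - l / X * μb - D * l ^ 2 ≤ jacobiMean μ (dualProfile μ ξ) l := fun l hl => by
      have h1 : X - l / X * μb - D * l ^ 2
          = ∫ y in (0 : ℝ)..1, (X - D * l ^ 2 - l / X * μ y) := by
        rw [intervalIntegral.integral_sub (by simp)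
          ((h.cont.const_mul _).intervalIntegrable _ _),
          intervalIntegral.integral_const_mul, ← hμb,
          intervalIntegral.integral_const, sub_zero, one_smul]
        ring
      rw [h1]
      have hcont := h.cont
      refine intervalIntegral.integral_mono_on zero_le_one
        ((by fun_prop : Continuous _).intervalIntegrable _ _)
        (((h.profile _).continuous_jacobiWeight l).intervalIntegrable _ _) fun y _ => ?_
      have hμy := h.pos y
      rw [le_div_iff₀ (by positivity)] at hl
      set x := 2 * l * μ y / X ^ 2 with hx
      have hlx : l * μ y = x * X ^ 2 / 2 := by rw [hx]; field_simp
      have habsx : |x| ≤ 1 := by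
        rw [hx, abs_div, abs_mul, abs_mul, abs_two, abs_of_pos hμy, abs_of_pos (pow_pos hX 2),
          div_le_one (by positivity)]
        have := mul_le_mul_of_nonneg_left (hz y) (abs_nonneg l)
        linarith
      have hDl : X * (x ^ 2 / 2) ≤ D * l ^ 2 := by
        have h2 : X * (x ^ 2 / 2) = 2 * μ y ^ 2 / X ^ 3 * l ^ 2 := by rw [hx]; field_simp
        rw [h2, hD]
        have := hz y
        gcongr
      have hlin : l / X * μ y = X * (x / 2) := by rw [hx]; field_simp
      rw [h.jacobiWeight_eq, hXsq]
      have h3 : X ^ 2 - 2 * l * μ y = X ^ 2 * (1 - x) := by linear_combination (-2) * hlx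
      rw [h3, Real.sqrt_mul (sq_nonneg X), Real.sqrt_sq hX.le]
      have h4 : 1 - x / 2 - x ^ 2 / 2 ≤ √(1 - x) := by
        refine Real.le_sqrt_of_sq_le ?_
        have hx1 := abs_le.1 habsx
        have h5 : 0 ≤ x ^ 2 * ((1 - x) * (3 + x)) :=
          mul_nonneg (sq_nonneg x) (mul_nonneg (by linarith) (by linarith))
        nlinarith
      have h5 := mul_le_mul_of_nonneg_left h4 hX.le
      linarith
    set k := 1 - |v| * μb / X with hk
    have hquad : ∀ l, |l| ≤ X ^ 2 / (2 * μ z) → l * k ≤ |v| * D * l ^ 2 := fun l hl => by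
      have h1 := mul_le_mul_of_nonneg_left (hJ l hl) (abs_nonneg v)
      have h2 := hlev l fun y => by
        refine (le_abs_self l).trans (hl.trans ?_)
        have := h.pos y
        have := hz y
        rw [dualProfile, hXsq]
        gcongr
      have h3 : l * k = l - |v| * (l / X * μb) := by rw [hk]; field_simp
      linarith
    -- `k` is the derivative at level `0` of the expression maximized by level `0`
    have hk0 : k = 0 := by
      by_contra hne
      have hkp := abs_pos.2 hne
      have hl0 : 0 < X ^ 2 / (2 * μ z) := by positivity
      have hD0 : 0 ≤ |v| * D := by positivity
      set t := min (X ^ 2 / (2 * μ z) / |k|) (1 / (|v| * D + 1)) with ht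
      have ht0 : 0 < t := by positivity
      have ht1 : t * |k| ≤ X ^ 2 / (2 * μ z) := by
        rw [← le_div_iff₀ hkp]
        exact min_le_left _ _
      have ht2 : t * (|v| * D + 1) ≤ 1 := by
        rw [← le_div_iff₀ (by positivity)]
        exact min_le_right _ _
      have h1 := hquad (t * k) (by rwa [abs_mul, abs_of_pos ht0])
      have h2 : 0 < t * k ^ 2 := by positivity
      have h3 : t * k ^ 2 * (1 - |v| * D * t) ≤ 0 := by linarith
      nlinarith
    have hX' : X = |v| * μb := by
      have : |v| * μb / X = 1 := by linarith
      rwa [div_eq_one_iff_eq hX.ne', eq_comm] at this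
    have hv : v ≠ 0 := fun hv => by simp [hv] at hX'; linarith
    refine mul_right_cancel₀ hv ?_
    rw [← habs, hX']
    linear_combination μb * abs_mul_abs_self v

end IsCoefficient

/-- The slope at rest, per unit of force, of the effective density of `μ`, where `z` is a maximum
of `μ`. -/
noncomputable def stickSlope (μ : ℝ → ℝ) (z : ℝ) : ℝ := ∫ y in (0 : ℝ)..1, √(1 - μ y / μ z)

namespace IsCoefficient

variable {μ : ℝ → ℝ}

theorem continuous_sqrt_one_sub (h : IsCoefficient μ) (z : ℝ) :
    Continuous fun y => √(1 - μ y / μ z) := by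
  have := h.cont
  fun_prop

theorem effectiveDensity_nonneg (h : IsCoefficient μ) (ξ v : ℝ) : 0 ≤ effectiveDensity μ ξ v :=
  (h.profile ξ).cellEnergy_nonneg v

theorem exists_lt (h : IsCoefficient μ) {z : ℝ} (hz : ∀ y, μ y ≤ μ z) {y₁ y₂ : ℝ}
    (hne : μ y₁ ≠ μ y₂) : ∃ y ∈ Icc (0 : ℝ) 1, μ y < μ z := by
  obtain ⟨y, hy⟩ : ∃ y, μ y < μ z := by
    by_contra! hge
    exact hne (((hz y₁).antisymm (hge y₁)).trans ((hge y₂).antisymm (hz y₂)))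
  have e := exists_mem_Icc_of_periodic h.per y
  exact ⟨Int.fract y, e.1, e.2.symm ▸ hy⟩

theorem integral_lt (h : IsCoefficient μ) {z : ℝ} (hz : ∀ y, μ y ≤ μ z) {y₁ y₂ : ℝ}
    (hne : μ y₁ ≠ μ y₂) : ∫ y in (0 : ℝ)..1, μ y < μ z := by
  obtain ⟨y, hy, hlt⟩ := h.exists_lt hz hne
  have h1 : 0 < ∫ y in (0 : ℝ)..1, (μ z - μ y) :=
    intervalIntegral.integral_pos one_pos (continuous_const.sub h.cont).continuousOn
      (fun y _ => sub_nonneg.2 (hz y)) ⟨y, hy, sub_pos.2 hlt⟩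
  rw [intervalIntegral.integral_sub (by simp) (h.cont.intervalIntegrable _ _)] at h1
  simpa using h1

theorem stickSlope_pos (h : IsCoefficient μ) {z : ℝ} (hz : ∀ y, μ y ≤ μ z) {y₁ y₂ : ℝ}
    (hne : μ y₁ ≠ μ y₂) : 0 < stickSlope μ z := by
  obtain ⟨y, hy, hlt⟩ := h.exists_lt hz hne
  refine intervalIntegral.integral_pos one_pos (h.continuous_sqrt_one_sub z).continuousOn
    (fun _ _ => Real.sqrt_nonneg _) ⟨y, hy, Real.sqrt_pos.2 ?_⟩
  rwa [sub_pos, div_lt_one (h.pos z)]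

/-- The contribution of the top level `ξ ^ 2 / (2 * μ z)`. -/
theorem stickSlope_le (h : IsCoefficient μ) {z : ℝ} (hz : ∀ y, μ y ≤ μ z) (ξ v : ℝ) :
    |v| * (|ξ| * stickSlope μ z) ≤ effectiveDensity μ ξ v - effectiveDensity μ ξ 0 := by
  have hz0 := h.pos z
  have h1 := (h.profile ξ).le_cellEnergy (l := ξ ^ 2 / (2 * μ z)) (fun y => by
    have := h.pos y
    have := hz y
    rw [dualProfile]
    gcongr) v
  have h2 : jacobiMean μ (dualProfile μ ξ) (ξ ^ 2 / (2 * μ z)) = |ξ| * stickSlope μ z := by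
    rw [jacobiMean, stickSlope, ← intervalIntegral.integral_const_mul]
    refine intervalIntegral.integral_congr fun y _ => ?_
    simp only [h.jacobiWeight_eq]
    rw [← Real.sqrt_sq_eq_abs, ← Real.sqrt_mul (sq_nonneg ξ)]
    congr 1
    field_simp
  rw [h2] at h1
  rw [h.effectiveDensity_zero hz]
  have : cellEnergy μ (dualProfile μ ξ) v = effectiveDensity μ ξ v := rfl
  linarith

theorem le_stickSlope (h : IsCoefficient μ) {z : ℝ} (hz : ∀ y, μ y ≤ μ z) (ξ v : ℝ) :
    effectiveDensity μ ξ v - effectiveDensity μ ξ 0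
      ≤ |v| * (|ξ| * stickSlope μ z) + μ z / 2 * v ^ 2 := by
  have hz0 := h.pos z
  rw [h.effectiveDensity_zero hz, sub_le_iff_le_add]
  refine (h.profile ξ).cellEnergy_le fun l hl => ?_
  have hlz := hl z
  rw [dualProfile] at hlz
  set β := ξ ^ 2 / (2 * μ z) with hβ
  have hs : 0 ≤ β - l := sub_nonneg.2 hlz
  have hξβ : ξ ^ 2 = 2 * β * μ z := by rw [hβ]; field_simp
  have hJ : jacobiMean μ (dualProfile μ ξ) l ≤ |ξ| * stickSlope μ z + √(2 * (β - l) * μ z) := by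
    have h1 : |ξ| * stickSlope μ z + √(2 * (β - l) * μ z)
        = ∫ y in (0 : ℝ)..1, (|ξ| * √(1 - μ y / μ z) + √(2 * (β - l) * μ z)) := by
      rw [intervalIntegral.integral_add
        (((h.continuous_sqrt_one_sub z).const_mul _).intervalIntegrable _ _) (by simp),
        intervalIntegral.integral_const_mul]
      simp [stickSlope]
    rw [h1]
    refine intervalIntegral.integral_mono_on zero_le_one
      (((h.profile _).continuous_jacobiWeight l).intervalIntegrable _ _)
      (((h.continuous_sqrt_one_sub z).const_mul |ξ|).add_const _ |>.intervalIntegrable _ _)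
      fun y _ => ?_
    have h2 : 0 ≤ 1 - μ y / μ z := sub_nonneg.2 ((div_le_one hz0).2 (hz y))
    have h3 : 2 * (β - l) * μ y ≤ 2 * (β - l) * μ z := by
      have := hz y
      gcongr
    have h4 : ξ ^ 2 * (1 - μ y / μ z) = ξ ^ 2 - 2 * β * μ y := by
      rw [hβ]; field_simp
    rw [h.jacobiWeight_eq, ← Real.sqrt_sq_eq_abs, ← Real.sqrt_mul (sq_nonneg ξ), h4]
    have h5 : 0 ≤ ξ ^ 2 - 2 * β * μ y := h4 ▸ mul_nonneg (sq_nonneg ξ) h2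
    have h6 : 0 ≤ 2 * (β - l) * μ z := by positivity
    refine Real.sqrt_le_iff.2 ⟨by positivity, ?_⟩
    have := Real.sq_sqrt h5
    have := Real.sq_sqrt h6
    nlinarith [mul_nonneg (Real.sqrt_nonneg (ξ ^ 2 - 2 * β * μ y))
      (Real.sqrt_nonneg (2 * (β - l) * μ z))]
  have h1 := mul_le_mul_of_nonneg_left hJ (abs_nonneg v)
  have h2 : |v| * √(2 * (β - l) * μ z) ≤ (β - l) + μ z / 2 * v ^ 2 := by
    have e1 : √(2 * (β - l) * μ z) = √(2 * (β - l)) * √(μ z) := Real.sqrt_mul (by positivity) _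
    have e2 := Real.sq_sqrt hz0.le
    have e3 := Real.sq_sqrt (show 0 ≤ 2 * (β - l) by positivity)
    have e4 := sq_nonneg (√(2 * (β - l)) - |v| * √(μ z))
    rw [sub_sq, mul_pow, e2, e3, sq_abs] at e4
    rw [e1]
    linarith
  linarith

theorem effectiveDensity_zero_le (h : IsCoefficient μ) (ξ v : ℝ) :
    effectiveDensity μ ξ 0 ≤ effectiveDensity μ ξ v :=
  (h.profile ξ).cellEnergy_zero_le v

theorem isDissipationPotential (h : IsCoefficient μ) (ξ : ℝ) : IsDissipationPotential fun v =>
    ENNReal.ofReal (effectiveDensity μ ξ v - effectiveDensity μ ξ 0) where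
  convex := by
    refine convexOn_ofReal ?_ fun v => sub_nonneg.2 (h.effectiveDensity_zero_le ξ v)
    exact (h.profile ξ).convexOn_cellEnergy.add (convexOn_const _ convex_univ)
  lsc := (ENNReal.continuous_ofReal.comp
    ((h.profile ξ).continuous_cellEnergy.sub continuous_const)).lowerSemicontinuous
  zero := by simp

theorem legendreDual_effectiveDensity_sub (h : IsCoefficient μ) (ξ : ℝ) :
    legendreDual (fun v => ENNReal.ofReal (effectiveDensity μ ξ v - effectiveDensity μ ξ 0)) ξ
      = ENNReal.ofReal (effectiveDensity μ ξ 0) := by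
  have hμ := h.integral_pos
  refine legendreDual_ofReal_sub (w := ξ / ∫ y in (0 : ℝ)..1, μ y) (h.effectiveDensity_zero_le ξ)
    (h.young ξ) ?_
  have := h.effectiveDensity_contact (ξ / ∫ y in (0 : ℝ)..1, μ y)
  rwa [mul_div_cancel₀ _ hμ.ne'] at this

/-- The averaged quadratic potential is contact equivalent to the effective density. -/
theorem isContactEquivalent (h : IsCoefficient μ) :
    IsContactEquivalent (fun v ξ => ENNReal.ofReal (effectiveDensity μ ξ v))
      fun v => ENNReal.ofReal ((∫ y in (0 : ℝ)..1, μ y) / 2 * v ^ 2) := by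
  have hμ := h.integral_pos
  set μb := ∫ y in (0 : ℝ)..1, μ y with hμb
  ext ⟨v, ξ⟩
  simp only [contactSet, subdifferentialGraph, mem_ofPred_eq]
  have hquad : ∀ w : ℝ, ((ENNReal.ofReal (μb / 2 * w ^ 2) : ℝ≥0∞) : EReal)
      = ((μb / 2 * w ^ 2 : ℝ) : EReal) := fun w => by
    rw [EReal.coe_ennreal_ofReal, max_eq_left (by positivity)]
  simp only [hquad, EReal.coe_ennreal_ofReal, max_eq_left (h.effectiveDensity_nonneg _ _),
    EReal.coe_eq_coe_iff, ne_eq, ENNReal.ofReal_ne_top, not_false_eq_true, true_and, ← EReal.coe_add,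
    EReal.coe_le_coe_iff]
  constructor
  · intro hc w
    rw [h.eq_of_effectiveDensity_eq hc, ← hμb]
    nlinarith [mul_nonneg hμ.le (sq_nonneg (w - v))]
  · intro hsub
    -- the minimum of the quadratic polynomial in `w`
    have h1 := hsub (v + (ξ - μb * v) / μb)
    set d := (ξ - μb * v) / μb with hd
    have h2 : ξ = μb * v + μb * d := by rw [hd]; field_simp; ring
    rw [h2] at h1
    have h3 : μb * d ^ 2 ≤ 0 := by nlinarith
    have h4 : d = 0 := by
      by_contra hne
      have : 0 < μb * d ^ 2 := by positivity
      linarith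
    rw [h4, mul_zero, add_zero] at h2
    rw [h2]
    exact h.effectiveDensity_contact v

end IsCoefficient

/-! ### The wiggly family -/

/-- A coefficient `μ q y`, periodic in `y` and uniformly positive. -/
structure IsWigglyCoefficient (μ : ℝ → ℝ → ℝ) (m : ℝ) : Prop where
  cont : Continuous fun p : ℝ × ℝ => μ p.1 p.2
  per : ∀ q, Function.Periodic (μ q) 1
  pos : 0 < m
  le : ∀ q y, m ≤ μ q y

namespace IsWigglyCoefficient

variable {μ : ℝ → ℝ → ℝ} {m : ℝ}

theorem coefficient (h : IsWigglyCoefficient μ m) (q : ℝ) : IsCoefficient (μ q) where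
  cont := h.cont.comp (by fun_prop : Continuous fun y : ℝ => (q, y))
  per := h.per q
  pos y := h.pos.trans_le (h.le q y)

theorem profileField (h : IsWigglyCoefficient μ m) {X : Type*} [TopologicalSpace X] {f ξ : X → ℝ}
    (hf : Continuous f) (hξ : Continuous ξ) :
    IsProfileField (fun p => μ (f p)) (fun p => dualProfile (μ (f p)) (ξ p)) m := by
  have hμ : Continuous fun p : X × ℝ => μ (f p.1) p.2 :=
    h.cont.comp (by fun_prop : Continuous fun p : X × ℝ => (f p.1, p.2))
  exact {
    cont_a := hμ
    cont_b := by
      refine ((hξ.comp continuous_fst).pow 2).div (hμ.const_mul 2) fun p => ?_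
      have := (h.coefficient (f p.1)).pos p.2
      positivity
    per_a := fun p => h.per (f p)
    per_b := fun p => ((h.coefficient (f p)).profile (ξ p)).per_b
    pos := h.pos
    le_a := fun p => h.le (f p)
    nonneg_b := fun p => ((h.coefficient (f p)).profile (ξ p)).nonneg_b }

theorem continuous_effectiveDensity (h : IsWigglyCoefficient μ m) {X : Type*} [TopologicalSpace X]
    {f ξ g : X → ℝ} (hf : Continuous f) (hξ : Continuous ξ) (hg : Continuous g) :
    Continuous fun p => effectiveDensity (μ (f p)) (ξ p) (g p) :=
  (h.profileField hf hξ).continuous_cellEnergy.comp (by fun_prop : Continuous fun p => (p, g p))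

/-- Gamma-convergence of the dissipation functionals under the force `ξ`. -/
theorem gammaConverges (h : IsWigglyCoefficient μ m) {ξ : ℝ → ℝ} (hξ : Continuous ξ) {T : ℝ}
    (hT : 0 < T) :
    GammaConverges (fun ε => actionFunctional hT fun q v =>
        wigglyDissipation μ ε q v + legendreDual (wigglyDissipation μ ε q) (ξ q))
      (actionFunctional hT fun q v => ENNReal.ofReal (effectiveDensity (μ q) (ξ q) v)) := by
  have heq : ∀ ε, (fun q v : ℝ =>
      wigglyDissipation μ ε q v + legendreDual (wigglyDissipation μ ε q) (ξ q))
        = oscillatingLagrangian μ (fun q => dualProfile (μ q) (ξ q)) ε := fun ε => by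
    funext q v
    have hpos := (h.coefficient q).pos (q / ε)
    have hd := legendreDual_quadratic hpos (ξ q)
    change ENNReal.ofReal (μ q (q / ε) / 2 * v ^ 2)
      + legendreDual (fun v => ENNReal.ofReal (μ q (q / ε) / 2 * v ^ 2)) (ξ q) = _
    rw [hd, ← ENNReal.ofReal_add (by positivity) (by positivity)]
    rfl
  simp_rw [heq]
  exact (h.profileField continuous_id hξ).gammaConverges hT

end IsWigglyCoefficient

theorem C1Fun.continuous_deriv (E : C1Fun) : Continuous (deriv E.1) :=
  E.2.continuous_deriv le_rfl

/-- The tilt that turns the force `-E'` into the constant force `ξ`. -/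
def constantForceTilt (E : C1Fun) (ξ : ℝ) : C1Fun :=
  ⟨fun q => -ξ * q - E.1 q, by have := E.2; fun_prop⟩

theorem deriv_constantForceTilt (E : C1Fun) (ξ q : ℝ) :
    deriv (constantForceTilt E ξ).1 q = -ξ - deriv E.1 q := by
  have h1 : HasDerivAt (fun q : ℝ => -ξ * q) (-ξ) q := by
    simpa using (hasDerivAt_id q).const_mul (-ξ)
  exact (h1.sub ((E.2.differentiable one_ne_zero) q).hasDerivAt).deriv

theorem energyConverges_wigglySystem (μ : ℝ → ℝ → ℝ) (E : C1Fun) :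
    EnergyConverges (wigglySystem μ E) E :=
  gammaConverges_const_of_continuous (continuous_coe_real_ereal.comp E.2.continuous)

/-- The simple EDP limit of the dissipation potentials, `M₀(q, v, ξ) - M₀(q, 0, ξ)` for the force
`ξ = -E'(q)`. -/
noncomputable def simpleLimit {μ : ℝ → ℝ → ℝ} {m : ℝ} (h : IsWigglyCoefficient μ m) (E : C1Fun) :
    DissipationPotential where
  toFun q v := ENNReal.ofReal (effectiveDensity (μ q) (-deriv E.1 q) v
    - effectiveDensity (μ q) (-deriv E.1 q) 0)
  isDissipationPotential q := (h.coefficient q).isDissipationPotential _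

namespace IsWigglyCoefficient

variable {μ : ℝ → ℝ → ℝ} {m : ℝ}

theorem basicAssumption (h : IsWigglyCoefficient μ m) (E : C1Fun) :
    BasicAssumption (wigglySystem μ E) E
      fun q v η => ENNReal.ofReal (effectiveDensity (μ q) (η - deriv E.1 q) v) where
  energy := energyConverges_wigglySystem μ E
  measurable := by
    have := E.continuous_deriv
    exact (ENNReal.continuous_ofReal.comp (h.continuous_effectiveDensity
      (by fun_prop) (by fun_prop) (by fun_prop))).measurable
  dissipation T hT F := by
    have h1 := E.continuous_deriv
    have h2 := F.continuous_deriv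
    have h3 := h.gammaConverges (ξ := fun q => -deriv E.1 q - deriv F.1 q) (by fun_prop) hT
    have h4 : ∀ q, -deriv F.1 q - deriv E.1 q = -deriv E.1 q - deriv F.1 q := fun q => by ring
    simp_rw [h4]
    exact h3
  convex q η := convexOn_ofReal ((h.coefficient q).profile _).convexOn_cellEnergy
    ((h.coefficient q).profile _).cellEnergy_nonneg
  lsc q η := (ENNReal.continuous_ofReal.comp
    ((h.coefficient q).profile _).continuous_cellEnergy).lowerSemicontinuous
  young q v ξ := by
    rw [effectiveIntegrand, add_sub_cancel_right, EReal.coe_ennreal_ofReal,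
      EReal.coe_le_coe_iff]
    exact ((h.coefficient q).young ξ v).trans (le_max_left _ _)
  min_zero q v ξ := ENNReal.ofReal_le_ofReal ((h.coefficient q).effectiveDensity_zero_le _ _)

theorem contactEDPConverges (h : IsWigglyCoefficient μ m) (E : C1Fun) :
    ContactEDPConverges (wigglySystem μ E) ⟨E, effectiveDissipation μ⟩ := by
  refine ⟨_, h.basicAssumption E, fun q => ?_⟩
  have h1 := (h.coefficient q).isContactEquivalent
  have h2 : effectiveIntegrand E
      (fun q v η => ENNReal.ofReal (effectiveDensity (μ q) (η - deriv E.1 q) v)) q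
        = fun v ξ => ENNReal.ofReal (effectiveDensity (μ q) ξ v) := by
    funext v ξ
    rw [effectiveIntegrand, add_sub_cancel_right]
  exact h2 ▸ h1

theorem continuous_simpleLimit (h : IsWigglyCoefficient μ m) (E : C1Fun) :
    Continuous fun p : ℝ × ℝ => simpleLimit h E p.1 p.2 := by
  have := E.continuous_deriv
  exact ENNReal.continuous_ofReal.comp ((h.continuous_effectiveDensity (by fun_prop) (by fun_prop)
    (by fun_prop)).sub (h.continuous_effectiveDensity (by fun_prop) (by fun_prop) (by fun_prop)))

theorem legendreDual_simpleLimit (h : IsWigglyCoefficient μ m) (E : C1Fun) (q : ℝ) :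
    legendreDual (simpleLimit h E q) (-deriv E.1 q)
      = ENNReal.ofReal (effectiveDensity (μ q) (-deriv E.1 q) 0) :=
  (h.coefficient q).legendreDual_effectiveDensity_sub _

theorem simpleLimit_add_dual (h : IsWigglyCoefficient μ m) (E : C1Fun) (q v : ℝ) :
    simpleLimit h E q v + legendreDual (simpleLimit h E q) (-deriv E.1 q)
      = ENNReal.ofReal (effectiveDensity (μ q) (-deriv E.1 q) v) := by
  have hq := h.coefficient q
  rw [h.legendreDual_simpleLimit]
  simp only [simpleLimit]
  rw [← ENNReal.ofReal_add (sub_nonneg.2 (hq.effectiveDensity_zero_le _ _))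
    (hq.effectiveDensity_nonneg _ _), sub_add_cancel]

theorem simpleEDPConverges (h : IsWigglyCoefficient μ m) (E : C1Fun) :
    SimpleEDPConverges (wigglySystem μ E) ⟨E, simpleLimit h E⟩ := by
  refine ⟨energyConverges_wigglySystem μ E, fun T hT => ?_⟩
  have := E.continuous_deriv
  have h1 := h.gammaConverges (ξ := fun q => -deriv E.1 q) (by fun_prop) hT
  simp_rw [← h.simpleLimit_add_dual E] at h1
  exact h1

/-- The limit functional determines a continuous potential: constant curves give the dual part, and
short affine curves the primal part. -/
theorem eq_simpleLimit (h : IsWigglyCoefficient μ m) (E : C1Fun) {R : DissipationPotential}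
    (hR : Continuous fun p : ℝ × ℝ => R p.1 p.2)
    (hconv : SimpleEDPConverges (wigglySystem μ E) ⟨E, R⟩) : R = simpleLimit h E := by
  have hE := E.continuous_deriv
  set L : ℝ → ℝ → ℝ≥0∞ := fun q v => R q v + legendreDual (R q) (-deriv E.1 q) with hL
  set L' : ℝ → ℝ → ℝ≥0∞ := fun q v =>
    ENNReal.ofReal (effectiveDensity (μ q) (-deriv E.1 q) v) with hL'
  have hact : ∀ (T : ℝ) (hT : 0 < T), actionFunctional hT L = actionFunctional hT L' :=
    fun T hT => (hconv.2 T hT).unique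
      (h.gammaConverges (ξ := fun q => -deriv E.1 q) (by fun_prop) hT)
  have hdual : ∀ q, legendreDual (R q) (-deriv E.1 q)
      = ENNReal.ofReal (effectiveDensity (μ q) (-deriv E.1 q) 0) := fun q => by
    have hR0 := (R.isDissipationPotential q).zero
    have h1 : L q 0 = L' q 0 := by
      apply le_antisymm
      · refine le_of_actionFunctional_le (fun T hT x => (congrFun (hact T hT) x).le) q 0 ?_ ?_
        · simpa using lowerSemicontinuousAt_const
        · simpa using upperSemicontinuousAt_const
      · refine le_of_actionFunctional_le (fun T hT x => (congrFun (hact T hT) x).ge) q 0 ?_ ?_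
        · simpa using lowerSemicontinuousAt_const
        · simpa using upperSemicontinuousAt_const
    simpa [hL, hL', hR0] using h1
  have hLeq : ∀ q v, L q v = L' q v := fun q v => by
    have hc : Continuous fun t : ℝ => L (q + v * t) v := by
      simp only [hL, hdual]
      refine Continuous.add (hR.comp (by fun_prop : Continuous fun t : ℝ => (q + v * t, v))) ?_
      exact ENNReal.continuous_ofReal.comp
        (h.continuous_effectiveDensity (by fun_prop) (by fun_prop) (by fun_prop))
    have hc' : Continuous fun t : ℝ => L' (q + v * t) v :=
      ENNReal.continuous_ofReal.comp
        (h.continuous_effectiveDensity (by fun_prop) (by fun_prop) (by fun_prop))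
    exact le_antisymm
      (le_of_actionFunctional_le (fun T hT x => (congrFun (hact T hT) x).le) q v
        hc.continuousAt.lowerSemicontinuousAt hc'.continuousAt.upperSemicontinuousAt)
      (le_of_actionFunctional_le (fun T hT x => (congrFun (hact T hT) x).ge) q v
        hc'.continuousAt.lowerSemicontinuousAt hc.continuousAt.upperSemicontinuousAt)
  have hfun : R.toFun = (simpleLimit h E).toFun := by
    funext q v
    have h1 := hLeq q v
    simp only [hL, hL', ← h.simpleLimit_add_dual E q v, hdual, h.legendreDual_simpleLimit] at h1
    exact (ENNReal.add_left_inj ENNReal.ofReal_ne_top).1 h1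
  cases R
  cases hS : simpleLimit h E
  rw [hS] at hfun
  cases hfun
  rfl

theorem simpleLimit_not_quadratic (h : IsWigglyCoefficient μ m) (E : C1Fun) {q : ℝ}
    (hne : ∃ y₁ y₂, μ q y₁ ≠ μ q y₂) (hE : deriv E.1 q ≠ 0) :
    ¬ ∃ a : ℝ, ∀ v, simpleLimit h E q v = ENNReal.ofReal (a / 2 * v ^ 2) := by
  rintro ⟨a, ha⟩
  obtain ⟨y₁, y₂, hne⟩ := hne
  have hq := h.coefficient q
  obtain ⟨z, hz⟩ := hq.exists_forall_le
  have hs := hq.stickSlope_pos hz hne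
  have hc : 0 < |-deriv E.1 q| * stickSlope (μ q) z :=
    mul_pos (abs_pos.2 (neg_ne_zero.2 hE)) hs
  set c := |-deriv E.1 q| * stickSlope (μ q) z with hcdef
  -- a velocity at which the linear term exceeds the quadratic one
  set v := c / (|a| + 1) with hv
  have hv0 : 0 < v := by positivity
  have hva : v * (|a| + 1) = c := by rw [hv]; field_simp
  have h1 := hq.stickSlope_le hz (-deriv E.1 q) v
  rw [← hcdef, abs_of_pos hv0] at h1
  have h2 : ENNReal.ofReal (v * c) ≤ ENNReal.ofReal (a / 2 * v ^ 2) :=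
    (ENNReal.ofReal_le_ofReal h1).trans (ha v).le
  have h3 : a / 2 * v ^ 2 < v * c := by
    have := le_abs_self a
    rw [← hva]
    nlinarith [mul_pos hv0 hv0, abs_nonneg a]
  exact absurd h2 (not_le.2 ((ENNReal.ofReal_lt_ofReal_iff (by positivity)).2 h3))

theorem abs_deriv_le_of_simpleLimit_eq (h : IsWigglyCoefficient μ m) {E₁ E₂ : C1Fun} {q : ℝ}
    (hne : ∃ y₁ y₂, μ q y₁ ≠ μ q y₂) (heq : simpleLimit h E₁ q = simpleLimit h E₂ q) :
    |deriv E₁.1 q| ≤ |deriv E₂.1 q| := by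
  obtain ⟨y₁, y₂, hne⟩ := hne
  have hq := h.coefficient q
  obtain ⟨z, hz⟩ := hq.exists_forall_le
  have hs := hq.stickSlope_pos hz hne
  have hz0 := hq.pos z
  refine le_of_mul_le_mul_right ?_ hs
  refine le_of_forall_pos_le_add fun e he => ?_
  -- the velocity at which the quadratic error of `le_stickSlope` is `v * e`
  set v := 2 * e / μ q z with hv
  have hv0 : 0 < v := by positivity
  have h1 := hq.stickSlope_le hz (-deriv E₁.1 q) v
  have h2 := hq.le_stickSlope hz (-deriv E₂.1 q) v
  have h3 : effectiveDensity (μ q) (-deriv E₁.1 q) v - effectiveDensity (μ q) (-deriv E₁.1 q) 0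
      ≤ effectiveDensity (μ q) (-deriv E₂.1 q) v - effectiveDensity (μ q) (-deriv E₂.1 q) 0 :=
    (ENNReal.ofReal_le_ofReal_iff (sub_nonneg.2 (hq.effectiveDensity_zero_le _ _))).1
      (congrFun heq v).le
  simp only [abs_neg, abs_of_pos hv0] at h1 h2
  have h4 : μ q z / 2 * v ^ 2 = v * e := by rw [hv]; field_simp
  have h5 := (h1.trans h3).trans h2
  rw [h4, ← mul_add] at h5
  exact le_of_mul_le_mul_left h5 hv0

/-- A dual sum would bound the effective density from below by the potential with the maximum of
`μ` in place of its mean; on the contact set this is impossible. -/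
theorem not_tiltEDPConverges (h : IsWigglyCoefficient μ m) {q : ℝ}
    (hne : ∃ y₁ y₂, μ q y₁ ≠ μ q y₂) (E : C1Fun) (G₀ : GradientSystem) :
    ¬ TiltEDPConverges (wigglySystem μ E) G₀ := by
  rintro ⟨N₀, hN, hsum⟩
  obtain ⟨E', R⟩ := G₀
  obtain rfl : E' = E := by
    refine Subtype.ext (funext fun x => ?_)
    have := congrFun (hN.energy.unique (energyConverges_wigglySystem μ E)) x
    exact EReal.coe_eq_coe_iff.1 this
  have hE := E'.continuous_deriv
  have hsum' : ∀ q v ξ, N₀ q v (ξ + deriv E'.1 q) = R q v + legendreDual (R q) ξ :=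
    fun q v ξ => hsum q v ξ
  have hact : ∀ ξ (T : ℝ) (hT : 0 < T),
      actionFunctional hT (fun q v => N₀ q v (ξ + deriv E'.1 q))
        = actionFunctional hT fun q v => ENNReal.ofReal (effectiveDensity (μ q) ξ v) := by
    intro ξ T hT
    have h1 := (hN.dissipation T hT (constantForceTilt E' ξ)).unique
      ((h.basicAssumption E').dissipation T hT (constantForceTilt E' ξ))
    simp_rw [deriv_constantForceTilt] at h1
    have h2 : ∀ q, -(-ξ - deriv E'.1 q) = ξ + deriv E'.1 q := fun q => by ring
    simp_rw [h2, add_sub_cancel_right] at h1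
    exact h1
  have hdual : ∀ q ξ, legendreDual (R q) ξ = ENNReal.ofReal (effectiveDensity (μ q) ξ 0) := by
    intro q ξ
    have hR0 := (R.isDissipationPotential q).zero
    have h1 : N₀ q 0 (ξ + deriv E'.1 q) = ENNReal.ofReal (effectiveDensity (μ q) ξ 0) := by
      apply le_antisymm
      · refine le_of_actionFunctional_le (L := fun q v => N₀ q v (ξ + deriv E'.1 q))
          (fun T hT x => (congrFun (hact ξ T hT) x).le) q 0 ?_ ?_
        · simpa using lowerSemicontinuousAt_const
        · simpa using upperSemicontinuousAt_const
      · refine le_of_actionFunctional_le (L' := fun q v => N₀ q v (ξ + deriv E'.1 q))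
          (fun T hT x => (congrFun (hact ξ T hT) x).ge) q 0 ?_ ?_
        · simpa using lowerSemicontinuousAt_const
        · simpa using upperSemicontinuousAt_const
    rwa [hsum', hR0, zero_add] at h1
  obtain ⟨y₁, y₂, hne⟩ := hne
  obtain ⟨z, hz⟩ := (h.coefficient q).exists_forall_le
  -- The point `z` maximizes `μ q` at the given `q` only; it serves as a test point at all states,
  -- which makes the lower bound continuous in the state.
  have hRlow : ∀ q v, ENNReal.ofReal (μ q z / 2 * v ^ 2) ≤ R q v := by
    intro q v
    have hq := h.coefficient q
    have hqz := hq.pos z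
    have h1 : ENNReal.ofReal (μ q z * v * v) - R q v ≤ ENNReal.ofReal (μ q z / 2 * v ^ 2) := by
      refine (le_iSup (fun w => ENNReal.ofReal (μ q z * v * w) - R q w) v).trans ?_
      refine (hdual q (μ q z * v)).le.trans (ENNReal.ofReal_le_ofReal ?_)
      refine (hq.profile _).cellEnergy_le fun l hl => ?_
      rw [abs_zero, zero_mul, add_zero]
      refine (hl z).trans (le_of_eq ?_)
      rw [dualProfile]
      field_simp
    have h2 := tsub_le_iff_left.1 h1
    have h3 : μ q z * v * v = μ q z / 2 * v ^ 2 + μ q z / 2 * v ^ 2 := by ring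
    rw [h3, ENNReal.ofReal_add (by positivity) (by positivity)] at h2
    exact (ENNReal.add_le_add_iff_right ENNReal.ofReal_ne_top).1 h2
  have hq := h.coefficient q
  have hμb := hq.integral_pos
  set μb := ∫ y in (0 : ℝ)..1, μ q y with hμbdef
  have hqz := hq.pos z
  have hkey : ENNReal.ofReal (μ q z / 2 * 1 ^ 2 + effectiveDensity (μ q) μb 0)
      ≤ ENNReal.ofReal (effectiveDensity (μ q) μb 1) := by
    refine le_of_actionFunctional_le
      (L := fun q v => ENNReal.ofReal (μ q z / 2 * v ^ 2 + effectiveDensity (μ q) μb 0))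
      (L' := fun q v => ENNReal.ofReal (effectiveDensity (μ q) μb v)) (fun T hT x => ?_) q 1
      (Continuous.continuousAt ?_).lowerSemicontinuousAt
      (Continuous.continuousAt ?_).upperSemicontinuousAt
    · rw [← hact μb T hT]
      unfold actionFunctional
      split_ifs
      · refine lintegral_mono fun t => ?_
        have hqt := h.coefficient (IccExtend hT.le x t)
        have := (hqt.pos z).le
        simp only [hsum', hdual]
        rw [ENNReal.ofReal_add (by positivity) (hqt.effectiveDensity_nonneg _ _)]
        exact add_le_add_left (hRlow _ _) _
      · exact le_rfl
    · have h1 : Continuous fun t : ℝ => μ (q + 1 * t) z :=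
        h.cont.comp (by fun_prop : Continuous fun t : ℝ => (q + 1 * t, z))
      exact ENNReal.continuous_ofReal.comp (Continuous.add ((h1.div_const 2).mul_const _)
        (h.continuous_effectiveDensity (by fun_prop) (by fun_prop) (by fun_prop)))
    · exact ENNReal.continuous_ofReal.comp
        (h.continuous_effectiveDensity (by fun_prop) (by fun_prop) (by fun_prop))
  rw [ENNReal.ofReal_le_ofReal_iff (hq.effectiveDensity_nonneg _ _)] at hkey
  have hc := hq.effectiveDensity_contact 1
  rw [← hμbdef, mul_one, mul_one] at hc
  rw [hc, hq.effectiveDensity_zero hz] at hkey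
  have hlt : μb < μ q z := hq.integral_lt hz hne
  have h1 : 2 * μ q z * (μ q z / 2 * 1 ^ 2 + μb ^ 2 / (2 * μ q z)) = μ q z ^ 2 + μb ^ 2 := by
    field_simp
  have h2 := mul_le_mul_of_nonneg_left hkey (show 0 ≤ 2 * μ q z by positivity)
  rw [h1] at h2
  nlinarith [mul_pos (sub_pos.2 hlt) (sub_pos.2 hlt)]

end IsWigglyCoefficient

theorem mainTheorem1 (μ : ℝ → ℝ → ℝ) (hμ_cont : Continuous fun p : ℝ × ℝ => μ p.1 p.2)
    (hμ_per : ∀ q y, μ q (y + 1) = μ q y) (m M : ℝ) (hm : 0 < m)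
    (hμ_bound : ∀ q y, m ≤ μ q y ∧ μ q y ≤ M) :
    (∀ E : C1Fun, ContactEDPConverges (wigglySystem μ E) ⟨E, effectiveDissipation μ⟩) ∧
    (∃ Rt : C1Fun → DissipationPotential,
      (∀ E : C1Fun,
        (Continuous fun p : ℝ × ℝ => Rt E p.1 p.2) ∧
        SimpleEDPConverges (wigglySystem μ E) ⟨E, Rt E⟩ ∧
        (∀ R : DissipationPotential, (Continuous fun p : ℝ × ℝ => R p.1 p.2) →
          SimpleEDPConverges (wigglySystem μ E) ⟨E, R⟩ → R = Rt E)) ∧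
      (∀ (E : C1Fun) (q : ℝ), (∃ y₁ y₂, μ q y₁ ≠ μ q y₂) → deriv E.1 q ≠ 0 →
        ¬ ∃ a : ℝ, ∀ v, Rt E q v = ENNReal.ofReal (a / 2 * v ^ 2)) ∧
      (∀ (E₁ E₂ : C1Fun) (q : ℝ), (∃ y₁ y₂, μ q y₁ ≠ μ q y₂) →
        |deriv E₁.1 q| ≠ |deriv E₂.1 q| → Rt E₁ q ≠ Rt E₂ q)) ∧
    ((∃ q y₁ y₂, μ q y₁ ≠ μ q y₂) →
      ∀ (E : C1Fun) (G₀ : GradientSystem), ¬ TiltEDPConverges (wigglySystem μ E) G₀) := by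
  have h : IsWigglyCoefficient μ m := ⟨hμ_cont, hμ_per, hm, fun q y => (hμ_bound q y).1⟩
  refine ⟨h.contactEDPConverges, ⟨simpleLimit h, fun E => ⟨h.continuous_simpleLimit E,
    h.simpleEDPConverges E, fun R hR hconv => h.eq_simpleLimit E hR hconv⟩,
    fun E q hne hE => h.simpleLimit_not_quadratic E hne hE, fun E₁ E₂ q hne hE heq => hE ?_⟩,
    fun ⟨q, hne⟩ E G₀ => h.not_tiltEDPConverges hne E G₀⟩
  exact le_antisymm (h.abs_deriv_le_of_simpleLimit_eq hne heq)
    (h.abs_deriv_le_of_simpleLimit_eq hne heq.symm)
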